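/- **Setup.** A two-receiver memoryless broadcast channel $W_{YZ|X}$ has finite alphabets $\mathcal X,\mathcal Y,\mathcal Z$. An $(n,K)$ consensus code consists of an encoder $f:[1:K]\to\mathcal X^n$ and decoders $g_B:\mathcal Y^n\to[1:K]\cup\{\bot\}$, $g_C:\mathcal Z^n\to[1:K]\cup\{\bot\}$. Its error probability is $$P_e=\max\Big(\max_{m}\big(1-\Pr(g_B(Y^n)=g_C(Z^n)=m\mid X^n=f(m))\big),\ \max_{x^n\in\mathcal X^n}\Pr(g_B(Y^n)\ne g_C(Z^n)\mid X^n=x^n)\Big).$$ A rate $R\ge 0$ is achievable with consensus if there is $\epsilon>0$ such that for all sufficiently large $n$ there is an $(n,\lfloor 2^{nR}\rfloor)$ consensus code with $P_e\le 2^{-n\epsilon}$; the consensus capacity $C_{\mathrm{Byz}}$ is the supremum of all such rates. The common-message capacity is $C_{\mathrm{com\text{-}msg}}=\max_{P_X}\min(I(X;Y),I(X;Z))$, with mutual information in bits. The characteristic graph of $W_{YZ|X}$ is the bipartite graph on the disjoint union $\mathcal Y\sqcup\mathcal Z$ with an edge $\{y,z\}$ whenever $W_{YZ|X}(y,z|x)>0$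 for some $x$. The common channel $W_{V|X}$ has as outputs the connected components $v$ of this graph, and $W_{V|X}(v|x)$ is the sum of $W_{YZ|X}(y,z|x)$ over the edges $\{y,z\}$ of $v$; its capacity is $C_{\mathrm{p\text{-}to\text{-}p}}(W_{V|X})=\max_{P_X}I(X;V)$. The two-step binary erasure broadcast channel with parameters $p\in[0,1]$, $q\in(0,1]$ has $\mathcal X=\{0,1\}$, $\mathcal Y=\mathcal Z=\{0,1,\tilde 0,\tilde 1,e\}$ and $$W_{YZ|X}(y,z|x)=\begin{cases}1-p,&y=z=x,\\ p\,Q(y|x)Q(z|x),&y,z\in\{\tilde 0,\tilde 1,e\},\\ 0,&\text{otherwise,}\end{cases}\qquad Q(e|x)=q,\ Q(\tilde x|x)=1-q.$$ **Theorem.** For the two-step binary erasure broadcast channel with $p\in[0,1]$, $q\in(0,1]$, the two maxima are attained, the supremum defining $C_{\mathrm{Byz}}$ is finite, and: 1. $C_{\mathrm{com\text{-}msg}}=1-pq$ and $C_{\mathrm{p\text{-}to\text{-}p}}(W_{V|X})=1-p$. 2. If $p<1$, then $C_{\mathrm{Byz}}=1-pq=C_{\mathrm{com\text{-}msg}}\ge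 C_{\mathrm{p\text{-}to\text{-}p}}(W_{V|X})=1-p$, and the inequality is strict if moreover $p>0$ and $q<1$. 3. If $p=1$, then $C_{\mathrm{Byz}}=0$. 4. If $p=1$ and $q<1$, then for all $n$ and all $K\ge 2$, every $(n,K)$ consensus code for this channel satisfies $$P_e\ \ge\ \frac{1}{2+n\rho},\qquad \rho=\frac{5}{\min(q^2,(1-q)^2)}.$$ -/

import Mathlib

open scoped BigOperators

/-! ## Finite channels, mutual information, point-to-point capacity -/

/-- A point-to-point channel `W(v | x)` with finite output alphabet `V`. -/
structure FiniteChannel (X V : Type) [Fintype V] where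
  /-- `prob x v` is the probability of the output `v` given the input `x`. -/
  prob : X → V → ℝ
  nonneg : ∀ x v, 0 ≤ prob x v
  sum_one : ∀ x, ∑ v, prob x v = 1

/-- Mutual information (in bits) of a joint probability mass function `J` on `A × B`:
`∑ J(a,b) log₂ (J(a,b) / (J_A(a) J_B(b)))`, where terms with `J(a,b) = 0` are `0`. -/
noncomputable def mutualInfo {A B : Type} [Fintype A] [Fintype B] (J : A → B → ℝ) : ℝ :=
  ∑ a, ∑ b, J a b * Real.logb 2 (J a b / ((∑ b', J a b') * (∑ a', J a' b)))

namespace FiniteChannel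

variable {X V : Type} [Fintype X] [Fintype V]

/-- `I(X;V)` for input distribution `P` and channel `W`. -/
noncomputable def info (W : FiniteChannel X V) (P : X → ℝ) : ℝ :=
  mutualInfo (fun x v => P x * W.prob x v)

/-- The values `I(X;V)` as `P_X` ranges over all probability mass functions on `X`. -/
def infoValues (W : FiniteChannel X V) : Set ℝ :=
  {r | ∃ P ∈ stdSimplex ℝ X, r = W.info P}

/-- Point-to-point capacity `max_{P_X} I(X;V)`. -/
noncomputable def capacity (W : FiniteChannel X V) : ℝ := sSup W.infoValues

end FiniteChannel

/-! ## Two-receiver broadcast channels -/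

/-- A two-receiver memoryless broadcast channel `W(y, z | x)`. -/
structure BroadcastChannel (X Y Z : Type) [Fintype Y] [Fintype Z] where
  /-- `prob x y z` is the probability of the outputs `(y, z)` given the input `x`. -/
  prob : X → Y → Z → ℝ
  nonneg : ∀ x y z, 0 ≤ prob x y z
  sum_one : ∀ x, ∑ y, ∑ z, prob x y z = 1

namespace BroadcastChannel

variable {X Y Z : Type} [Fintype X] [Fintype Y] [Fintype Z]

/-- The marginal channel `W_{Y|X}` to the first receiver. -/
def marginalY (W : BroadcastChannel X Y Z) : FiniteChannel X Y where
  prob x y := ∑ z, W.prob x y z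
  nonneg x y := Finset.sum_nonneg fun z _ => W.nonneg x y z
  sum_one x := W.sum_one x

/-- The marginal channel `W_{Z|X}` to the second receiver. -/
def marginalZ (W : BroadcastChannel X Y Z) : FiniteChannel X Z where
  prob x z := ∑ y, W.prob x y z
  nonneg x z := Finset.sum_nonneg fun y _ => W.nonneg x y z
  sum_one x := by rw [Finset.sum_comm]; exact W.sum_one x

/-- The values `min (I(X;Y)) (I(X;Z))` as `P_X` ranges over all probability mass functions. -/
def commonMessageValues (W : BroadcastChannel X Y Z) : Set ℝ :=
  {r | ∃ P ∈ stdSimplex ℝ X, r = min (W.marginalY.info P) (W.marginalZ.info P)}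

/-- The common-message capacity `max_{P_X} min (I(X;Y), I(X;Z))`. -/
noncomputable def commonMessageCapacity (W : BroadcastChannel X Y Z) : ℝ :=
  sSup W.commonMessageValues

/-- The characteristic graph: the bipartite graph on the disjoint union of `Y` and `Z` in which
`y` and `z` are joined iff `W(y, z | x) > 0` for some input `x`. -/
def charGraph (W : BroadcastChannel X Y Z) : SimpleGraph (Y ⊕ Z) :=
  SimpleGraph.fromRel fun a b =>
    ∃ y z x, a = Sum.inl y ∧ b = Sum.inr z ∧ 0 < W.prob x y z

/-- Output alphabet of the common channel: the connected components of the characteristic graph.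
(Output letters of probability zero under every input form one-vertex components, which contain
no edge and hence have probability zero under the common channel.) -/
def CommonAlphabet (W : BroadcastChannel X Y Z) : Type := W.charGraph.ConnectedComponent

noncomputable instance (W : BroadcastChannel X Y Z) : Fintype W.CommonAlphabet :=
  haveI : Finite W.CommonAlphabet :=
    inferInstanceAs (Finite (Quot W.charGraph.Reachable))
  Fintype.ofFinite _

/-- The connected component of a vertex of the characteristic graph. -/
def component (W : BroadcastChannel X Y Z) (a : Y ⊕ Z) : W.CommonAlphabet :=
  W.charGraph.connectedComponentMk a

open Classical in
/-- `W(v | x)` of the common channel: the sum of `W(y, z | x)` over the edges `{y, z}` of the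
connected component `v`. -/
noncomputable def commonProb (W : BroadcastChannel X Y Z) (x : X) (v : W.CommonAlphabet) : ℝ :=
  ∑ y, ∑ z,
    if W.charGraph.Adj (Sum.inl y) (Sum.inr z) ∧
        W.component (Sum.inl y) = v ∧ W.component (Sum.inr z) = v
    then W.prob x y z else 0

theorem adj_of_prob_pos (W : BroadcastChannel X Y Z) {x : X} {y : Y} {z : Z}
    (h : 0 < W.prob x y z) : W.charGraph.Adj (Sum.inl y) (Sum.inr z) := by
  rw [charGraph, SimpleGraph.fromRel_adj]
  exact ⟨by simp, Or.inl ⟨y, z, x, rfl, rfl, h⟩⟩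

/-- The common channel `W_{V|X}`. -/
noncomputable def commonChannel (W : BroadcastChannel X Y Z) :
    FiniteChannel X W.CommonAlphabet where
  prob := W.commonProb
  nonneg x v := by
    classical
    refine Finset.sum_nonneg fun y _ => Finset.sum_nonneg fun z _ => ?_
    split_ifs
    · exact W.nonneg x y z
    · exact le_rfl
  sum_one x := by
    classical
    rw [← W.sum_one x]
    simp only [commonProb]
    rw [Finset.sum_comm]
    refine Finset.sum_congr rfl fun y _ => ?_
    rw [Finset.sum_comm]
    refine Finset.sum_congr rfl fun z _ => ?_
    rcases (W.nonneg x y z).eq_or_lt with h | h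
    · simp [← h]
    · have hadj := W.adj_of_prob_pos h
      have hc : W.component (Sum.inr z) = W.component (Sum.inl y) :=
        (SimpleGraph.ConnectedComponent.eq.mpr hadj.reachable).symm
      rw [Finset.sum_eq_single (W.component (Sum.inl y))]
      · simp [hadj, hc]
      · intro v _ hv
        rw [if_neg]
        rintro ⟨-, h1, -⟩
        exact hv h1.symm
      · simp

/-! ## Consensus codes and consensus capacity -/

/-- `W^n(y^n, z^n | x^n)` for `n` memoryless uses of the channel. -/
def blockProb (W : BroadcastChannel X Y Z) {n : ℕ} (x : Fin n → X) (y : Fin n → Y)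
    (z : Fin n → Z) : ℝ :=
  ∏ i, W.prob (x i) (y i) (z i)

open Classical in
/-- `Pr((Y^n, Z^n) ∈ E | X^n = x^n)`. -/
noncomputable def condProb (W : BroadcastChannel X Y Z) {n : ℕ} (x : Fin n → X)
    (E : (Fin n → Y) → (Fin n → Z) → Prop) : ℝ :=
  ∑ y, ∑ z, if E y z then W.blockProb x y z else 0

end BroadcastChannel

/-- An `(n, K)` consensus code: a deterministic encoder and two deterministic decoders, whose
output is a message or `⊥` (here `none`). -/
structure ConsensusCode (X Y Z : Type) (n K : ℕ) where
  enc : Fin K → (Fin n → X)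
  decB : (Fin n → Y) → Option (Fin K)
  decC : (Fin n → Z) → Option (Fin K)

namespace ConsensusCode

variable {X Y Z : Type} [Fintype X] [Fintype Y] [Fintype Z] {n K : ℕ}

/-- `λ_m = 1 - Pr(g_B(Y^n) = g_C(Z^n) = m | f(m))`. -/
noncomputable def honestError (c : ConsensusCode X Y Z n K) (W : BroadcastChannel X Y Z)
    (m : Fin K) : ℝ :=
  1 - W.condProb (c.enc m) fun y z => c.decB y = some m ∧ c.decC z = some m

/-- `η_{x^n} = Pr(g_B(Y^n) ≠ g_C(Z^n) | x^n)`. -/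
noncomputable def disagreement (c : ConsensusCode X Y Z n K) (W : BroadcastChannel X Y Z)
    (x : Fin n → X) : ℝ :=
  W.condProb x fun y z => c.decB y ≠ c.decC z

/-- Error probability `P_e = max(λ, η)` with `λ = max_m λ_m` and `η = max_{x^n} η_{x^n}`
(maxima over finite sets). -/
noncomputable def errorProb (c : ConsensusCode X Y Z n K) (W : BroadcastChannel X Y Z) : ℝ :=
  max (⨆ m : Fin K, c.honestError W m) (⨆ x : Fin n → X, c.disagreement W x)

end ConsensusCode

namespace BroadcastChannel

variable {X Y Z : Type} [Fintype X] [Fintype Y] [Fintype Z]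

/-- Rate `R` is achievable with consensus: there is an `ε > 0` such that for all sufficiently
large `n` there is an `(n, ⌊2^{nR}⌋)` consensus code with `P_e ≤ 2^{-nε}`. -/
def Achievable (W : BroadcastChannel X Y Z) (R : ℝ) : Prop :=
  ∃ ε : ℝ, 0 < ε ∧ ∃ n₀ : ℕ, ∀ n : ℕ, n₀ ≤ n →
    ∃ c : ConsensusCode X Y Z n ⌊(2 : ℝ) ^ ((n : ℝ) * R)⌋₊,
      c.errorProb W ≤ (2 : ℝ) ^ (-((n : ℝ) * ε))

/-- The set of (nonnegative) rates achievable with consensus. -/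
def achievableRates (W : BroadcastChannel X Y Z) : Set ℝ := {R | 0 ≤ R ∧ W.Achievable R}

/-- The consensus capacity `C_Byz`. -/
noncomputable def consensusCapacity (W : BroadcastChannel X Y Z) : ℝ := sSup W.achievableRates

end BroadcastChannel

/-! ## The two-step binary erasure broadcast channel -/

/-- The output alphabet `{0, 1, 0~, 1~, e}` of each receiver; `false` and `true` stand for the
bits `0` and `1`. -/
inductive ErasureOutput : Type
  | plain (b : Bool)
  | tilde (b : Bool)
  | erased
  deriving DecidableEq, Fintype

/-- `Q(y | x)`: the binary erasure channel with erasure probability `q` and tilded outputs. -/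
def tildeErasure (q : ℝ) (x : Bool) : ErasureOutput → ℝ
  | .plain _ => 0
  | .tilde b => if b = x then 1 - q else 0
  | .erased => q

/-- `W(y, z | x)` of the two-step binary erasure broadcast channel: `1 - p` if `y = z = x`,
`p Q(y | x) Q(z | x)` if `y, z ∈ {0~, 1~, e}`, and `0` otherwise. -/
def twoStepProb (p q : ℝ) (x : Bool) (y z : ErasureOutput) : ℝ :=
  (if y = .plain x ∧ z = .plain x then 1 - p else 0) +
    p * tildeErasure q x y * tildeErasure q x z

theorem ErasureOutput.sum_eq (f : ErasureOutput → ℝ) :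
    ∑ y, f y = f (.plain true) + f (.plain false) + f (.tilde true) + f (.tilde false)
      + f .erased := by
  have : (Finset.univ : Finset ErasureOutput) =
      {.plain true, .plain false, .tilde true, .tilde false, .erased} := by decide
  rw [this]
  simp
  ring

theorem tildeErasure_nonneg {q : ℝ} (hq : q ∈ Set.Ioc (0 : ℝ) 1) (x : Bool)
    (y : ErasureOutput) : 0 ≤ tildeErasure q x y := by
  have h1 := hq.1
  have h2 := hq.2
  cases y <;> simp only [tildeErasure]
  · exact le_rfl
  · split_ifs <;> linarith
  · linarith

/-- The two-step binary erasure broadcast channel, `p ∈ [0,1]`, `q ∈ (0,1]`. -/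
def twoStepErasure (p q : ℝ) (hp : p ∈ Set.Icc (0 : ℝ) 1) (hq : q ∈ Set.Ioc (0 : ℝ) 1) :
    BroadcastChannel Bool ErasureOutput ErasureOutput where
  prob := twoStepProb p q
  nonneg x y z := by
    have h1 := hp.1
    have h2 := hp.2
    refine add_nonneg ?_ (mul_nonneg (mul_nonneg h1 (tildeErasure_nonneg hq x y))
      (tildeErasure_nonneg hq x z))
    split_ifs <;> linarith
  sum_one x := by
    cases x <;> simp [ErasureOutput.sum_eq, twoStepProb, tildeErasure] <;> ring

/-! Each receiver sees, up to the labels of the letters, a binary erasure channel with erasure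
probability `p * q`, and the common channel is one with erasure probability `p`. There the mutual
information is the input entropy times the non-erasure probability, so the uniform input attains
both maxima.

For the upper bound on the consensus rate, honest decoding at one receiver suffices. Given the
erasure positions, a word with `k` unerased letters has at most `2 ^ k` values, and `k ≥ n * τ` is
exponentially unlikely for `τ > 1 - p * q` (`sum_wordProb_decode_le`, `code_size_mul_le`).

For achievability with `p < 1`, untilded letters are seen by both receivers at once and anchor the
agreement. A receiver accepts a codeword that is not contradicted by an untilded letter and by at
most `D` tilded ones, provided enough letters are unerased. Tilded letters are truthful, so a
codeword within distance `D` of the input always passes the tilded test, and its acceptance depends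
only on what both receivers see. A codeword farther away survives the untilded test with probability
at most `p ^ (D + 1)`. Disagreement therefore requires too many erasures or an accepted far
codeword. The latter must be unlikely for all `2 ^ n` inputs simultaneously. To this end one word is
drawn at random from each of `K` blocks of a Gilbert–Varshamov packing; the weights are bounded and
have small mean, so an exponential moment and a union bound over inputs give a good draw
(`exists_selection`). The spacing of the packing makes honest decoding unique.

For `p = 1` the outputs are conditionally independent. If C has letter `i` erased, its decision is
insensitive to input bit `i`, and near-agreement passes this on to B: flipping one bit moves the law
of B's decision by at most `2 * P_e / q`. Between two codewords, at most `n` flips must move a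
probability from at most `P_e` to at least `1 - P_e`. This gives a bound of order `1 / n`, which
excludes exponential decay. -/

/-! ### Mutual information of the receiver channels and of the common channel -/

/-- For a binary-input channel whose outputs either reveal the input (`κ v = some b`) or carry no
information about it (`κ v = none`), the mutual information is the entropy of the input scaled by
the probability `1 - r` of revelation. -/
theorem FiniteChannel.info_eq_of_erasure {V : Type} [Fintype V] (W : FiniteChannel Bool V)
    (κ : V → Option Bool) (r : ℝ)
    (h0 : ∀ x v, κ v = some (!x) → W.prob x v = 0)
    (h1 : ∀ x v, κ v = none → W.prob x v = W.prob true v)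
    (hr : ∑ v, (if κ v = none then W.prob true v else 0) = r)
    {P : Bool → ℝ} (hP : P ∈ stdSimplex ℝ Bool) :
    W.info P = (1 - r) * (Real.binEntropy (P true) / Real.log 2) := by
  have hs : P true + P false = 1 := by simpa using hP.2
  -- For a revealing output the ratio in the logarithm is `(P x)⁻¹`; for an uninformative one it is
  -- `1`. Every summand is thus a fixed multiple of `P x * logb 2 (P x)⁻¹`.
  have hterm : ∀ x v, P x * W.prob x v * Real.logb 2 (P x * W.prob x v /
      ((∑ v', P x * W.prob x v') * (∑ x', P x' * W.prob x' v))) =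
      (W.prob x v - if κ v = none then W.prob true v else 0) * (P x * Real.logb 2 (P x)⁻¹) := by
    intro x v
    rw [← Finset.mul_sum, W.sum_one, mul_one, Fintype.sum_bool]
    by_cases hz : P x * W.prob x v = 0
    · rcases mul_eq_zero.1 hz with h | h
      · simp [h]
      · rw [hz]
        by_cases hk : κ v = none
        · simp [hk, ← h1 x v hk]
        · simp [hk, h]
    have hPx : P x ≠ 0 := left_ne_zero_of_mul hz
    have hW : W.prob x v ≠ 0 := right_ne_zero_of_mul hz
    rcases hk : κ v with _ | b
    · have e : P true * W.prob true v + P false * W.prob false v = W.prob x v := by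
        rw [h1 x v hk, h1 false v hk, ← add_mul, hs, one_mul]
      rw [e, div_self hz]
      simp [h1 x v hk]
    · have hb : b = x := by
        by_contra hne
        exact hW (h0 x v (by rw [hk]; cases b <;> cases x <;> simp_all))
      subst hb
      have e : P true * W.prob true v + P false * W.prob false v = P b * W.prob b v := by
        cases b
        · rw [h0 true v (by simpa using hk)]; ring
        · rw [h0 false v (by simpa using hk)]; ring
      rw [e]
      have : P b * W.prob b v / (P b * (P b * W.prob b v)) = (P b)⁻¹ := by field_simp
      rw [this]
      simp
      ring
  have hcol : ∀ x, ∑ v, (W.prob x v - if κ v = none then W.prob true v else 0) = 1 - r := by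
    intro x
    rw [Finset.sum_sub_distrib, W.sum_one, hr]
  unfold FiniteChannel.info mutualInfo
  simp_rw [hterm, ← Finset.sum_mul, hcol]
  rw [Fintype.sum_bool, Real.binEntropy, show P false = 1 - P true by linarith]
  simp only [Real.logb]
  ring

theorem binEntropy_div_log_two_le_one (t : ℝ) : Real.binEntropy t / Real.log 2 ≤ 1 := by
  rw [div_le_one (Real.log_pos one_lt_two)]
  exact Real.binEntropy_le_log_two

theorem binEntropy_half_div_log_two : Real.binEntropy (1 / 2) / Real.log 2 = 1 := by
  rw [one_div, Real.binEntropy_two_inv, div_self (Real.log_pos one_lt_two).ne']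

theorem uniform_mem_stdSimplex_bool : (fun _ : Bool => (1 / 2 : ℝ)) ∈ stdSimplex ℝ Bool :=
  ⟨fun _ => by norm_num, by norm_num⟩

/-- The law of one receiver's output in the two-step erasure channel. -/
def receiverProb (p q : ℝ) (x : Bool) (y : ErasureOutput) : ℝ :=
  (if y = .plain x then 1 - p else 0) + p * tildeErasure q x y

theorem tildeErasure_sum (q : ℝ) (x : Bool) : ∑ y, tildeErasure q x y = 1 := by
  cases x <;> simp [ErasureOutput.sum_eq, tildeErasure]

theorem twoStepProb_comm (p q : ℝ) (x : Bool) (y z : ErasureOutput) :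
    twoStepProb p q x y z = twoStepProb p q x z y := by
  simp only [twoStepProb, and_comm]
  ring

theorem sum_twoStepProb (p q : ℝ) (x : Bool) (y : ErasureOutput) :
    ∑ z, twoStepProb p q x y z = receiverProb p q x y := by
  simp only [twoStepProb, receiverProb, Finset.sum_add_distrib, ← Finset.mul_sum,
    tildeErasure_sum, mul_one]
  by_cases h : y = .plain x <;> simp [h]

section
variable {p q : ℝ} (hp : p ∈ Set.Icc (0 : ℝ) 1) (hq : q ∈ Set.Ioc (0 : ℝ) 1)

theorem marginalY_prob : (twoStepErasure p q hp hq).marginalY.prob = receiverProb p q := by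
  funext x y
  exact sum_twoStepProb p q x y

theorem marginalZ_prob : (twoStepErasure p q hp hq).marginalZ.prob = receiverProb p q := by
  funext x y
  have h : ∑ z, twoStepProb p q x z y = ∑ z, twoStepProb p q x y z :=
    Finset.sum_congr rfl fun z _ => twoStepProb_comm p q x z y
  show ∑ z, twoStepProb p q x z y = _
  rw [h, sum_twoStepProb]

theorem info_of_prob_eq_receiverProb (W : FiniteChannel Bool ErasureOutput)
    (hW : W.prob = receiverProb p q) {P : Bool → ℝ} (hP : P ∈ stdSimplex ℝ Bool) :
    W.info P = (1 - p * q) * (Real.binEntropy (P true) / Real.log 2) := by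
  refine W.info_eq_of_erasure
    (fun y => match y with | .plain b => some b | .tilde b => some b | .erased => none)
    _ ?_ ?_ ?_ hP
  · rintro x (b | b | _) h <;> simp_all [receiverProb, tildeErasure]
  · rintro x (b | b | _) h <;> simp_all [receiverProb, tildeErasure]
  · simp [ErasureOutput.sum_eq, hW, receiverProb, tildeErasure]

theorem isGreatest_commonMessageValues :
    IsGreatest (twoStepErasure p q hp hq).commonMessageValues (1 - p * q) := by
  have h1 : 0 ≤ 1 - p * q := by nlinarith [hp.1, hp.2, hq.1, hq.2]
  have hY := fun {P} hP => info_of_prob_eq_receiverProb _ (marginalY_prob hp hq) (P := P) hP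
  have hZ := fun {P} hP => info_of_prob_eq_receiverProb _ (marginalZ_prob hp hq) (P := P) hP
  constructor
  · refine ⟨_, uniform_mem_stdSimplex_bool, ?_⟩
    rw [hY uniform_mem_stdSimplex_bool, hZ uniform_mem_stdSimplex_bool,
      binEntropy_half_div_log_two, mul_one, min_self]
  · rintro r ⟨P, hP, rfl⟩
    rw [hY hP, hZ hP, min_self]
    exact mul_le_of_le_one_right h1 (binEntropy_div_log_two_le_one _)

/-- The bit shown by an untilded letter; all other letters are mapped to `none`. -/
def plainBit : ErasureOutput ⊕ ErasureOutput → Option Bool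
  | .inl (.plain b) => some b
  | .inr (.plain b) => some b
  | _ => none

theorem plainBit_eq_of_prob_pos {x : Bool} {y z : ErasureOutput} (h : 0 < twoStepProb p q x y z) :
    plainBit (.inl y) = plainBit (.inr z) := by
  rcases y with b | b | _ <;> rcases z with c | c | _ <;>
    simp_all [twoStepProb, tildeErasure, plainBit]
  by_contra hne
  rw [if_neg] at h
  · exact lt_irrefl _ h
  · rintro ⟨rfl, rfl⟩; exact hne rfl

/-- The displayed bit is constant along edges. This invariant keeps the two untilded letters and the
erasure in three distinct components. -/
theorem plainBit_eq_of_component_eq {a b : ErasureOutput ⊕ ErasureOutput}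
    (h : (twoStepErasure p q hp hq).component a = (twoStepErasure p q hp hq).component b) :
    plainBit a = plainBit b := by
  obtain ⟨w⟩ := SimpleGraph.ConnectedComponent.eq.mp h
  clear h
  induction w with
  | nil => rfl
  | cons hadj _ ih =>
    rw [← ih]
    rw [BroadcastChannel.charGraph, SimpleGraph.fromRel_adj] at hadj
    rcases hadj.2 with ⟨y, z, x, rfl, rfl, h⟩ | ⟨y, z, x, rfl, rfl, h⟩
    · exact plainBit_eq_of_prob_pos h
    · exact (plainBit_eq_of_prob_pos h).symm

open Classical in
-- Every letter of positive probability in the tilded branch can occur together with an erasure at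
-- the other receiver, since `q > 0`; so it lies in the component of the erasure. Components that
-- split off in degenerate cases carry no mass.
theorem commonProb_eq {W : BroadcastChannel Bool ErasureOutput ErasureOutput}
    (hW : W = twoStepErasure p q hp hq) (x : Bool) (v : W.CommonAlphabet) :
    W.commonProb x v =
      (if W.component (.inl (.plain x)) = v then 1 - p else 0) +
      (if W.component (.inl .erased) = v then p else 0) := by
  have hWp : W.prob = twoStepProb p q := by rw [hW]; rfl
  have h1 : W.commonProb x v =
      ∑ y, (if W.component (.inl y) = v then receiverProb p q x y else 0) := by
    refine Finset.sum_congr rfl fun y _ => ?_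
    have h2 : ∀ z, (if W.charGraph.Adj (.inl y) (.inr z) ∧ W.component (.inl y) = v ∧
        W.component (.inr z) = v then W.prob x y z else 0) =
        if W.component (.inl y) = v then twoStepProb p q x y z else 0 := by
      intro z
      rw [← hWp]
      rcases (W.nonneg x y z).eq_or_lt with h | h
      · simp [← h]
      · have hadj := W.adj_of_prob_pos h
        have hc : W.component (.inr z) = W.component (.inl y) :=
          (SimpleGraph.ConnectedComponent.eq.mpr hadj.reachable).symm
        simp [hadj, hc]
    rw [Finset.sum_congr rfl fun z _ => h2 z]
    split_ifs
    · exact sum_twoStepProb p q x y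
    · simp
  have h3 : ∀ y, p * tildeErasure q x y ≠ 0 → W.component (.inl y) = W.component (.inl .erased) := by
    intro y hy
    have hpos : 0 < p * tildeErasure q x y :=
      lt_of_le_of_ne (mul_nonneg hp.1 (tildeErasure_nonneg hq x y)) hy.symm
    have key : ∀ y', 0 < p * tildeErasure q x y' → 0 < W.prob x y' .erased := by
      intro y' h
      rw [hWp]
      have : 0 < p * tildeErasure q x y' * q := mul_pos h hq.1
      simpa [twoStepProb, tildeErasure] using this
    have he : 0 < p * tildeErasure q x .erased :=
      mul_pos (lt_of_le_of_ne hp.1 (left_ne_zero_of_mul hy).symm) hq.1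
    exact SimpleGraph.ConnectedComponent.eq.mpr
      ((W.adj_of_prob_pos (key y hpos)).reachable.trans
        (W.adj_of_prob_pos (key .erased he)).symm.reachable)
  have h4 : ∀ y, (if W.component (.inl y) = v then receiverProb p q x y else 0) =
      (if W.component (.inl (.plain x)) = v then (if y = .plain x then 1 - p else 0) else 0) +
      (if W.component (.inl .erased) = v then p * tildeErasure q x y else 0) := by
    intro y
    by_cases hy : y = .plain x
    · subst hy
      simp [receiverProb, tildeErasure]
    · by_cases hz : p * tildeErasure q x y = 0
      · simp [receiverProb, hy, hz]
      · simp [receiverProb, hy, h3 y hz]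
  rw [h1, Finset.sum_congr rfl fun y _ => h4 y, Finset.sum_add_distrib]
  congr 1
  · split_ifs <;> simp
  · split_ifs
    · rw [← Finset.mul_sum, tildeErasure_sum, mul_one]
    · simp

theorem isGreatest_commonChannel_infoValues :
    IsGreatest (twoStepErasure p q hp hq).commonChannel.infoValues (1 - p) := by
  classical
  obtain ⟨W, hW⟩ : ∃ W, W = twoStepErasure p q hp hq := ⟨_, rfl⟩
  rw [← hW]
  have hne : ∀ {a b}, plainBit a ≠ plainBit b → W.component a ≠ W.component b :=
    fun h h' => h (plainBit_eq_of_component_eq hp hq (by subst hW; exact h'))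
  have hft : W.component (.inl (.plain false)) ≠ W.component (.inl (.plain true)) :=
    hne (by simp [plainBit])
  have hte : W.component (.inl (.plain true)) ≠ W.component (.inl .erased) :=
    hne (by simp [plainBit])
  have hfe : W.component (.inl (.plain false)) ≠ W.component (.inl .erased) :=
    hne (by simp [plainBit])
  have hprob : W.commonChannel.prob = W.commonProb := rfl
  have hI : ∀ {P : Bool → ℝ}, P ∈ stdSimplex ℝ Bool → W.commonChannel.info P =
      (1 - p) * (Real.binEntropy (P true) / Real.log 2) := by
    intro P hP
    refine W.commonChannel.info_eq_of_erasure
      (fun v => if v = W.component (.inl (.plain true)) then some true else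
        if v = W.component (.inl (.plain false)) then some false else none) p ?_ ?_ ?_ hP
    · intro x v h
      rw [hprob, commonProb_eq hp hq hW]
      split_ifs at h with h1 h2
      · cases x
        · subst h1; simp [hft, hte.symm]
        · simp at h
      · cases x
        · simp at h
        · subst h2; simp [hft.symm, hfe.symm]
    · intro x v h
      rw [hprob, commonProb_eq hp hq hW, commonProb_eq hp hq hW]
      split_ifs at h with h1 h2
      cases x
      · rw [if_neg (Ne.symm h1), if_neg (Ne.symm h2)]
      · rfl
    · rw [Finset.sum_eq_single (W.component (.inl .erased))]
      · rw [if_pos, hprob, commonProb_eq hp hq hW]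
        · simp [hte]
        · simp [hte.symm, hfe.symm]
      · intro v _ hv
        by_cases h1 : v = W.component (.inl (.plain true))
        · simp [h1]
        by_cases h2 : v = W.component (.inl (.plain false))
        · simp [h2, hft]
        rw [hprob, commonProb_eq hp hq hW, if_neg (Ne.symm h1), if_neg (Ne.symm hv), add_zero,
          ite_self]
      · simp
  have h1 : 0 ≤ 1 - p := by linarith [hp.2]
  constructor
  · refine ⟨_, uniform_mem_stdSimplex_bool, ?_⟩
    rw [hI uniform_mem_stdSimplex_bool, binEntropy_half_div_log_two, mul_one]
  · rintro r ⟨P, hP, rfl⟩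
    rw [hI hP]
    exact mul_le_of_le_one_right h1 (binEntropy_div_log_two_le_one _)
end

/-! ### Probabilities of events on words -/

theorem Finset.sum_univ_prod_apply {ι V : Type} [Fintype ι] [DecidableEq ι] [Fintype V]
    (F : ι → V → ℝ) : ∑ y : ι → V, ∏ i, F i (y i) = ∏ i, ∑ v, F i v := by
  rw [Finset.prod_univ_sum, Fintype.piFinset_univ]

namespace FiniteChannel
variable {X V : Type} [Fintype V] {n : ℕ}

open Classical in
/-- `Pr(V^n ∈ E | X^n = x^n)` for `n` memoryless uses of a point-to-point channel. -/
noncomputable def wordProb (W : FiniteChannel X V) (x : Fin n → X) (E : (Fin n → V) → Prop) : ℝ :=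
  ∑ y, if E y then ∏ i, W.prob (x i) (y i) else 0

theorem word_nonneg (W : FiniteChannel X V) (x : Fin n → X) (y : Fin n → V) :
    0 ≤ ∏ i, W.prob (x i) (y i) :=
  Finset.prod_nonneg fun _ _ => W.nonneg _ _

theorem wordProb_nonneg (W : FiniteChannel X V) (x : Fin n → X) (E : (Fin n → V) → Prop) :
    0 ≤ W.wordProb x E :=
  Finset.sum_nonneg fun y _ => by
    split_ifs
    exacts [W.word_nonneg x y, le_rfl]

theorem wordProb_mono (W : FiniteChannel X V) (x : Fin n → X) {E E' : (Fin n → V) → Prop}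
    (h : ∀ y, E y → E' y) : W.wordProb x E ≤ W.wordProb x E' := by
  refine Finset.sum_le_sum fun y _ => ?_
  by_cases hE : E y
  · rw [if_pos hE, if_pos (h y hE)]
  · rw [if_neg hE]
    split_ifs
    exacts [W.word_nonneg x y, le_rfl]

theorem wordProb_or_le (W : FiniteChannel X V) (x : Fin n → X) (E E' : (Fin n → V) → Prop) :
    W.wordProb x (fun y => E y ∨ E' y) ≤ W.wordProb x E + W.wordProb x E' := by
  unfold wordProb
  rw [← Finset.sum_add_distrib]
  refine Finset.sum_le_sum fun y _ => ?_
  have := W.word_nonneg x y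
  by_cases hE : E y <;> by_cases hE' : E' y <;> simp [hE, hE', this]

theorem wordProb_exists_le {ι : Type} [Fintype ι] (W : FiniteChannel X V) (x : Fin n → X)
    (E : ι → (Fin n → V) → Prop) :
    W.wordProb x (fun y => ∃ m, E m y) ≤ ∑ m, W.wordProb x (E m) := by
  classical
  unfold wordProb
  rw [Finset.sum_comm]
  refine Finset.sum_le_sum fun y _ => ?_
  have hn : ∀ m ∈ Finset.univ, 0 ≤ if E m y then ∏ i, W.prob (x i) (y i) else 0 := fun m _ => by
    split_ifs
    exacts [W.word_nonneg x y, le_rfl]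
  split_ifs with h
  · obtain ⟨m, hm⟩ := h
    refine le_trans ?_ (Finset.single_le_sum hn (Finset.mem_univ m))
    rw [if_pos hm]
  · exact Finset.sum_nonneg hn

/-- Markov's inequality with a weight of product form. -/
theorem wordProb_le_prod (W : FiniteChannel X V) (x : Fin n → X) (E : (Fin n → V) → Prop)
    (h : Fin n → V → ℝ) (h0 : ∀ i v, 0 ≤ h i v) (h1 : ∀ y, E y → 1 ≤ ∏ i, h i (y i)) :
    W.wordProb x E ≤ ∏ i, ∑ v, W.prob (x i) v * h i v := by
  rw [← Finset.sum_univ_prod_apply fun i v => W.prob (x i) v * h i v]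
  refine Finset.sum_le_sum fun y _ => ?_
  rw [Finset.prod_mul_distrib]
  split_ifs with hE
  · exact le_mul_of_one_le_right (W.word_nonneg x y) (h1 y hE)
  · exact mul_nonneg (W.word_nonneg x y) (Finset.prod_nonneg fun i _ => h0 i _)

theorem wordProb_true (W : FiniteChannel X V) (x : Fin n → X) :
    W.wordProb x (fun _ => True) = 1 := by
  simp only [wordProb, if_true]
  rw [Finset.sum_univ_prod_apply fun i v => W.prob (x i) v]
  simp [W.sum_one]

end FiniteChannel

namespace BroadcastChannel
variable {X Y Z : Type} [Fintype Y] [Fintype Z] {n : ℕ}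

theorem blockProb_nonneg (W : BroadcastChannel X Y Z) (x : Fin n → X) (y : Fin n → Y)
    (z : Fin n → Z) : 0 ≤ W.blockProb x y z :=
  Finset.prod_nonneg fun _ _ => W.nonneg _ _ _

theorem condProb_fst (W : BroadcastChannel X Y Z) (x : Fin n → X) (E : (Fin n → Y) → Prop) :
    W.condProb x (fun y _ => E y) = W.marginalY.wordProb x E := by
  refine Finset.sum_congr rfl fun y _ => ?_
  split_ifs
  · exact Finset.sum_univ_prod_apply fun i z => W.prob (x i) (y i) z
  · simp

theorem condProb_snd (W : BroadcastChannel X Y Z) (x : Fin n → X) (E : (Fin n → Z) → Prop) :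
    W.condProb x (fun _ z => E z) = W.marginalZ.wordProb x E := by
  unfold condProb
  rw [Finset.sum_comm]
  refine Finset.sum_congr rfl fun z _ => ?_
  split_ifs
  · exact Finset.sum_univ_prod_apply fun i y => W.prob (x i) y (z i)
  · simp

theorem condProb_mono (W : BroadcastChannel X Y Z) (x : Fin n → X)
    {E E' : (Fin n → Y) → (Fin n → Z) → Prop}
    (h : ∀ y z, W.blockProb x y z ≠ 0 → E y z → E' y z) : W.condProb x E ≤ W.condProb x E' := by
  refine Finset.sum_le_sum fun y _ => Finset.sum_le_sum fun z _ => ?_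
  have hn := W.blockProb_nonneg x y z
  by_cases h0 : W.blockProb x y z = 0
  · simp [h0]
  by_cases hE : E y z
  · rw [if_pos hE, if_pos (h y z h0 hE)]
  · rw [if_neg hE]
    split_ifs
    exacts [hn, le_rfl]

theorem condProb_or_le (W : BroadcastChannel X Y Z) (x : Fin n → X)
    (E E' : (Fin n → Y) → (Fin n → Z) → Prop) :
    W.condProb x (fun y z => E y z ∨ E' y z) ≤ W.condProb x E + W.condProb x E' := by
  unfold condProb
  simp_rw [← Finset.sum_add_distrib]
  refine Finset.sum_le_sum fun y _ => Finset.sum_le_sum fun z _ => ?_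
  have := W.blockProb_nonneg x y z
  by_cases hE : E y z <;> by_cases hE' : E' y z <;> simp [hE, hE', this]

theorem condProb_add_not (W : BroadcastChannel X Y Z) (x : Fin n → X)
    (E : (Fin n → Y) → (Fin n → Z) → Prop) :
    W.condProb x E + W.condProb x (fun y z => ¬ E y z) = 1 := by
  have h : W.condProb x (fun _ _ => True) = 1 :=
    (W.condProb_fst x fun _ => True).trans (W.marginalY.wordProb_true x)
  rw [← h]
  unfold condProb
  simp_rw [← Finset.sum_add_distrib]
  refine Finset.sum_congr rfl fun y _ => Finset.sum_congr rfl fun z _ => ?_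
  by_cases hE : E y z <;> simp [hE]

end BroadcastChannel

namespace ConsensusCode
variable {X Y Z : Type} [Fintype Y] [Fintype Z] {n K : ℕ}

theorem honestError_le_errorProb (c : ConsensusCode X Y Z n K) (W : BroadcastChannel X Y Z)
    (m : Fin K) : c.honestError W m ≤ c.errorProb W :=
  (le_ciSup (Set.finite_range _).bddAbove m).trans (le_max_left _ _)

theorem disagreement_le_errorProb [Finite X] (c : ConsensusCode X Y Z n K) (W : BroadcastChannel X Y Z)
    (x : Fin n → X) : c.disagreement W x ≤ c.errorProb W := by
  exact (le_ciSup (Set.finite_range _).bddAbove x).trans (le_max_right _ _)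

theorem errorProb_le (c : ConsensusCode X Y Z n K) (W : BroadcastChannel X Y Z) {a : ℝ}
    (ha : 0 ≤ a) (h1 : ∀ m, c.honestError W m ≤ a) (h2 : ∀ x, c.disagreement W x ≤ a) :
    c.errorProb W ≤ a :=
  max_le (Real.iSup_le h1 ha) (Real.iSup_le h2 ha)

theorem one_sub_errorProb_le (c : ConsensusCode X Y Z n K) (W : BroadcastChannel X Y Z)
    (m : Fin K) :
    1 - c.errorProb W ≤ W.marginalY.wordProb (c.enc m) fun y => c.decB y = some m := by
  have h1 := c.honestError_le_errorProb W m
  have h2 := W.condProb_mono (c.enc m)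
    (E := fun y z => c.decB y = some m ∧ c.decC z = some m)
    (E' := fun y _ => c.decB y = some m) fun y z _ h => h.1
  rw [W.condProb_fst] at h2
  unfold honestError at h1
  linarith

end ConsensusCode

/-! ### Large deviations of the number of unerased letters -/

/-- The moment generating function of a Bernoulli variable with mean `a`, centred at `τ > a`,
is less than one for some positive parameter. -/
theorem exists_bernoulli_mgf_lt_one {a τ : ℝ} (h : a < τ) :
    ∃ s : ℝ, 0 < s ∧ (1 - a) * Real.exp (s * (0 - τ)) + a * Real.exp (s * (1 - τ)) < 1 := by
  have hd : HasDerivAt (fun s : ℝ => (1 - a) * Real.exp (s * (0 - τ)) + a * Real.exp (s * (1 - τ)))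
      (a - τ) 0 := by
    have h1 : ∀ c : ℝ, HasDerivAt (fun s : ℝ => Real.exp (s * c)) c 0 := fun c => by
      simpa using ((hasDerivAt_id (0 : ℝ)).mul_const c).exp
    convert! ((h1 (0 - τ)).const_mul (1 - a)).add ((h1 (1 - τ)).const_mul a) using 1
    ring
  -- The function equals `1` at `s = 0` and has negative slope there.
  have hneg : a - τ < 0 := by linarith
  have := hd.tendsto_slope_zero_right.eventually (gt_mem_nhds hneg)
  obtain ⟨s, hs, hs0⟩ := (this.and self_mem_nhdsWithin).exists
  have hs0 : (0 : ℝ) < s := hs0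
  refine ⟨s, hs0, ?_⟩
  simp only [zero_add, zero_mul, Real.exp_zero, mul_one, smul_eq_mul] at hs
  have := (inv_mul_lt_iff₀ hs0).1 hs
  linarith

/-- The number of letters that are not erased. -/
def unerased {n : ℕ} (y : Fin n → ErasureOutput) : ℕ :=
  (Finset.univ.filter fun i => y i ≠ .erased).card

theorem unerased_eq_sum {n : ℕ} (y : Fin n → ErasureOutput) :
    (unerased y : ℝ) = ∑ i, if y i = .erased then (0 : ℝ) else 1 := by
  rw [unerased, Finset.card_filter]
  push_cast
  exact Finset.sum_congr rfl fun i _ => by split_ifs <;> simp_all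

section
variable {p q : ℝ} (hp : p ∈ Set.Icc (0 : ℝ) 1) (hq : q ∈ Set.Ioc (0 : ℝ) 1)

/-- The point-to-point channel seen by either receiver. -/
noncomputable def receiverChannel : FiniteChannel Bool ErasureOutput :=
  (twoStepErasure p q hp hq).marginalY

theorem receiverChannel_prob : (receiverChannel hp hq).prob = receiverProb p q :=
  marginalY_prob hp hq

theorem marginalY_eq : (twoStepErasure p q hp hq).marginalY = receiverChannel hp hq := rfl

theorem marginalZ_eq : (twoStepErasure p q hp hq).marginalZ = receiverChannel hp hq := by
  have h := (marginalZ_prob hp hq).trans (receiverChannel_prob hp hq).symm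
  cases h1 : (twoStepErasure p q hp hq).marginalZ
  cases h2 : receiverChannel hp hq
  rw [h1, h2] at h
  simpa using h

theorem wordProb_chernoff {n : ℕ} (x : Fin n → Bool) (E : (Fin n → ErasureOutput) → Prop) (s τ : ℝ)
    (hE : ∀ y, E y → 0 ≤ s * (unerased y - n * τ)) :
    (receiverChannel hp hq).wordProb x E ≤
      (p * q * Real.exp (s * (0 - τ)) + (1 - p * q) * Real.exp (s * (1 - τ))) ^ n := by
  refine (FiniteChannel.wordProb_le_prod _ x E
    (fun _ v => Real.exp (s * ((if v = .erased then 0 else 1) - τ)))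
    (fun _ _ => (Real.exp_pos _).le) fun y hy => ?_).trans_eq ?_
  · rw [← Real.exp_sum, ← Finset.mul_sum, Finset.sum_sub_distrib, ← unerased_eq_sum]
    simpa using hE y hy
  · rw [receiverChannel_prob]
    have : ∀ i, ∑ v, receiverProb p q (x i) v * Real.exp (s * ((if v = .erased then 0 else 1) - τ))
        = p * q * Real.exp (s * (0 - τ)) + (1 - p * q) * Real.exp (s * (1 - τ)) := by
      intro i
      cases x i <;> simp [ErasureOutput.sum_eq, receiverProb, tildeErasure] <;> ring
    simp [this]

theorem exists_unerased_upper_tail {τ : ℝ} (h : 1 - p * q < τ) :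
    ∃ γ : ℝ, 0 ≤ γ ∧ γ < 1 ∧ ∀ (n : ℕ) (x : Fin n → Bool),
      (receiverChannel hp hq).wordProb x (fun y => n * τ ≤ unerased y) ≤ γ ^ n := by
  obtain ⟨s, hs, hlt⟩ := exists_bernoulli_mgf_lt_one h
  have h0 : 0 ≤ p * q := mul_nonneg hp.1 hq.1.le
  have h1 : 0 ≤ 1 - p * q := by nlinarith [hp.1, hp.2, hq.1, hq.2]
  refine ⟨_, ?_, ?_, fun n x => wordProb_chernoff hp hq x _ s τ fun y hy => ?_⟩
  · positivity
  · simpa using hlt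
  · exact mul_nonneg hs.le (sub_nonneg.2 hy)

theorem exists_unerased_lower_tail {τ : ℝ} (h : τ < 1 - p * q) :
    ∃ γ : ℝ, 0 ≤ γ ∧ γ < 1 ∧ ∀ (n : ℕ) (x : Fin n → Bool),
      (receiverChannel hp hq).wordProb x (fun y => (unerased y : ℝ) < n * τ) ≤ γ ^ n := by
  -- Few unerased letters means many erasures: the Bernoulli variable is now the erasure, with mean
  -- `p * q` and threshold `1 - τ`, which turns `s` into `-s`.
  obtain ⟨s, hs, hlt⟩ := exists_bernoulli_mgf_lt_one (show p * q < 1 - τ by linarith)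
  have h0 : 0 ≤ p * q := mul_nonneg hp.1 hq.1.le
  have h1 : 0 ≤ 1 - p * q := by nlinarith [hp.1, hp.2, hq.1, hq.2]
  refine ⟨_, ?_, ?_, fun n x => wordProb_chernoff hp hq x _ (-s) τ fun y hy => ?_⟩
  · positivity
  · refine lt_of_eq_of_lt ?_ hlt
    rw [add_comm]
    congr 3 <;> ring
  · nlinarith
end

/-! ### Upper bound on the rate -/

section
variable {p q : ℝ} (hp : p ∈ Set.Icc (0 : ℝ) 1) (hq : q ∈ Set.Ioc (0 : ℝ) 1)

/-- Given the positions of the erasures, the output word takes at most `2 ^ unerased y` values. -/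
theorem sum_wordProb_decode_le {n K : ℕ} (f : Fin K → Fin n → Bool)
    (g : (Fin n → ErasureOutput) → Option (Fin K)) (τ : ℝ) :
    ∑ m, (receiverChannel hp hq).wordProb (f m)
      (fun y => g y = some m ∧ (unerased y : ℝ) < n * τ) ≤ (2 : ℝ) ^ (n * τ) := by
  classical
  -- The reference measure is the output law under a uniform input. It dominates each conditional
  -- law up to a factor `2` on unerased letters and `1` on the erasure.
  set v : ErasureOutput → ℝ := fun y => ∑ x, (1 / 2) * (receiverChannel hp hq).prob x y with hv
  have hv0 : ∀ y, 0 ≤ v y := fun y =>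
    Finset.sum_nonneg fun x _ => mul_nonneg (by norm_num) ((receiverChannel hp hq).nonneg x y)
  have hv1 : ∑ y, v y = 1 := by
    simp only [hv]
    rw [Finset.sum_comm]
    simp_rw [← Finset.mul_sum, (receiverChannel hp hq).sum_one]
    simp
  have hle : ∀ x y, (receiverChannel hp hq).prob x y ≤
      (2 : ℝ) ^ (if y = .erased then (0 : ℝ) else 1) * v y := by
    intro x y
    split_ifs with h
    · subst h
      simp only [hv, receiverChannel_prob]
      cases x <;> simp [receiverProb, tildeErasure]
    · have h1 := (receiverChannel hp hq).nonneg (!x) y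
      simp only [hv]
      cases x <;> simp at h1 ⊢ <;> linarith
  have hword : ∀ (x : Fin n → Bool) (y : Fin n → ErasureOutput), (unerased y : ℝ) < n * τ →
      ∏ i, (receiverChannel hp hq).prob (x i) (y i) ≤ (2 : ℝ) ^ (n * τ) * ∏ i, v (y i) := by
    intro x y hy
    calc ∏ i, (receiverChannel hp hq).prob (x i) (y i)
        ≤ ∏ i, (2 : ℝ) ^ (if y i = .erased then (0 : ℝ) else 1) * v (y i) :=
          Finset.prod_le_prod (fun i _ => (receiverChannel hp hq).nonneg _ _)
            fun i _ => hle _ _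
      _ = (2 : ℝ) ^ (unerased y : ℝ) * ∏ i, v (y i) := by
          rw [Finset.prod_mul_distrib, ← Real.rpow_sum_of_pos two_pos, unerased_eq_sum]
      _ ≤ _ := by
          gcongr
          · exact Finset.prod_nonneg fun i _ => hv0 _
          · norm_num
  unfold FiniteChannel.wordProb
  rw [Finset.sum_comm]
  calc _ ≤ ∑ y : Fin n → ErasureOutput, (2 : ℝ) ^ (n * τ) * ∏ i, v (y i) := by
        refine Finset.sum_le_sum fun y _ => ?_
        have h0 : 0 ≤ (2 : ℝ) ^ (n * τ) * ∏ i, v (y i) :=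
          mul_nonneg (by positivity) (Finset.prod_nonneg fun i _ => hv0 _)
        by_cases hy : (unerased y : ℝ) < n * τ
        -- For a fixed output word only the message `g y` contributes to the sum.
        · simp only [hy, and_true]
          rcases hg : g y with _ | m
          · simpa using h0
          · simpa using hword (f m) y hy
        · simpa [hy] using h0
    _ = (2 : ℝ) ^ (n * τ) := by
        rw [← Finset.mul_sum, Finset.sum_univ_prod_apply fun _ => v]
        simp [hv1]

theorem code_size_mul_le {n K : ℕ} (c : ConsensusCode Bool ErasureOutput ErasureOutput n K)
    {τ γ : ℝ} (hγ : ∀ x : Fin n → Bool,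
      (receiverChannel hp hq).wordProb x (fun y => n * τ ≤ unerased y) ≤ γ ^ n) :
    K * (1 - c.errorProb (twoStepErasure p q hp hq) - γ ^ n) ≤ (2 : ℝ) ^ (n * τ) := by
  refine le_trans ?_ (sum_wordProb_decode_le hp hq c.enc c.decB τ)
  have hm : ∀ m, 1 - c.errorProb (twoStepErasure p q hp hq) - γ ^ n ≤
      (receiverChannel hp hq).wordProb (c.enc m)
        (fun y => c.decB y = some m ∧ (unerased y : ℝ) < n * τ) := by
    intro m
    have h1 := c.one_sub_errorProb_le (twoStepErasure p q hp hq) m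
    have h2 := (receiverChannel hp hq).wordProb_mono (c.enc m) (E := fun y => c.decB y = some m)
      (E' := fun y => (c.decB y = some m ∧ (unerased y : ℝ) < n * τ) ∨ n * τ ≤ unerased y)
      fun y hy => by
        rcases lt_or_ge (unerased y : ℝ) (n * τ) with h | h
        · exact Or.inl ⟨hy, h⟩
        · exact Or.inr h
    have h3 := (receiverChannel hp hq).wordProb_or_le (c.enc m)
      (fun y => c.decB y = some m ∧ (unerased y : ℝ) < n * τ) (fun y => n * τ ≤ unerased y)
    rw [marginalY_eq] at h1
    linarith [hγ (c.enc m)]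
  calc _ = ∑ _m : Fin K, (1 - c.errorProb (twoStepErasure p q hp hq) - γ ^ n) := by
        rw [Finset.sum_const, Finset.card_univ, Fintype.card_fin, nsmul_eq_mul]
    _ ≤ _ := Finset.sum_le_sum fun m _ => hm m

theorem le_of_achievable {R : ℝ} (hR : 0 ≤ R) (h : (twoStepErasure p q hp hq).Achievable R) :
    R ≤ 1 - p * q := by
  by_contra! hlt
  obtain ⟨τ, hτ, hτR⟩ := exists_between hlt
  obtain ⟨γ, hγ0, hγ1, hγ⟩ := exists_unerased_upper_tail hp hq hτ
  obtain ⟨ε, hε, n₀, hc⟩ := h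
  have hr1 : (2 : ℝ) ^ (-ε) < 1 := Real.rpow_lt_one_of_one_lt_of_neg one_lt_two (by linarith)
  have hr2 : (2 : ℝ) ^ (τ - R) < 1 := Real.rpow_lt_one_of_one_lt_of_neg one_lt_two (by linarith)
  have t1 := (tendsto_pow_atTop_nhds_zero_of_lt_one (by positivity) hr1).eventually_lt_const
    (show (0 : ℝ) < 1 / 4 by norm_num)
  have t2 := (tendsto_pow_atTop_nhds_zero_of_lt_one (by positivity) hr2).eventually_lt_const
    (show (0 : ℝ) < 1 / 4 by norm_num)
  have t3 := (tendsto_pow_atTop_nhds_zero_of_lt_one hγ0 hγ1).eventually_lt_const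
    (show (0 : ℝ) < 1 / 4 by norm_num)
  obtain ⟨n, ⟨⟨h1, h2⟩, h3⟩, hn⟩ := (((t1.and t2).and t3).and (Filter.eventually_ge_atTop n₀)).exists
  have hcn := hc n hn
  obtain ⟨M, hM⟩ : ∃ M, M = (2 : ℝ) ^ ((n : ℝ) * R) := ⟨_, rfl⟩
  rw [← hM] at hcn
  obtain ⟨c, hPe⟩ := hcn
  have hsize := code_size_mul_le hp hq c (hγ n)
  rw [← Real.rpow_mul_natCast zero_le_two] at h1 h2
  rw [show -((n : ℝ) * ε) = -ε * n by ring] at hPe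
  have hM1 : 1 ≤ M := hM ▸ Real.one_le_rpow one_le_two (by positivity)
  -- Rounding down costs less than a factor `2` because `M ≥ 1`.
  have hfl : M / 2 < (⌊M⌋₊ : ℝ) := by
    have ha := Nat.lt_floor_add_one M
    have hb : (1 : ℝ) ≤ ⌊M⌋₊ := by exact_mod_cast (Nat.one_le_floor_iff M).2 hM1
    linarith
  have hτM : (2 : ℝ) ^ ((n : ℝ) * τ) = (2 : ℝ) ^ ((τ - R) * n) * M := by
    rw [hM, ← Real.rpow_add two_pos]
    ring_nf
  rw [hτM] at hsize
  have : (⌊M⌋₊ : ℝ) * (1 / 2) ≤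
      ⌊M⌋₊ * (1 - c.errorProb (twoStepErasure p q hp hq) - γ ^ n) := by
    gcongr
    linarith
  nlinarith
end

/-! ### The case `p = 1`: sensitivity of decisions to single input bits -/

/-- A function of `n` bits that changes by at most `a` when a single bit changes has oscillation
at most `n * a`. -/
theorem abs_sub_le_of_update {n : ℕ} (φ : (Fin n → Bool) → ℝ) {a : ℝ}
    (h : ∀ x i b, |φ (Function.update x i b) - φ x| ≤ a) (x y : Fin n → Bool) :
    |φ y - φ x| ≤ n * a := by
  -- The hybrid word agrees with `y` on `s` and with `x` elsewhere.
  have key : ∀ s : Finset (Fin n), |φ (s.piecewise y x) - φ x| ≤ s.card * a := by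
    intro s
    induction s using Finset.induction_on with
    | empty => simp
    | insert i s hi ih =>
      rw [Finset.piecewise_insert, Finset.card_insert_of_notMem hi]
      have := abs_sub_le (φ (Function.update (s.piecewise y x) i (y i))) (φ (s.piecewise y x)) (φ x)
      push_cast
      linarith [h (s.piecewise y x) i (y i)]
  simpa using key Finset.univ

section
variable {q : ℝ} (h1 : (1 : ℝ) ∈ Set.Icc (0 : ℝ) 1) (hq : q ∈ Set.Ioc (0 : ℝ) 1) {n : ℕ}

theorem receiverChannel_one_prob : (receiverChannel h1 hq).prob = tildeErasure q := by
  rw [receiverChannel_prob]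
  funext x y
  simp [receiverProb]

theorem blockProb_one (x : Fin n → Bool) (y z : Fin n → ErasureOutput) :
    (twoStepErasure 1 q h1 hq).blockProb x y z =
      (∏ i, (receiverChannel h1 hq).prob (x i) (y i)) *
        ∏ i, (receiverChannel h1 hq).prob (x i) (z i) := by
  rw [receiverChannel_one_prob, ← Finset.prod_mul_distrib]
  refine Finset.prod_congr rfl fun i _ => ?_
  simp [twoStepErasure, twoStepProb]

theorem wordProb_erased (x : Fin n → Bool) (i : Fin n) :
    (receiverChannel h1 hq).wordProb x (fun y => y i = .erased) = q := by
  classical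
  have h : ∀ y : Fin n → ErasureOutput,
      (if y i = .erased then ∏ j, (receiverChannel h1 hq).prob (x j) (y j) else 0) =
      ∏ j, (receiverChannel h1 hq).prob (x j) (y j) * if j = i ∧ y j ≠ .erased then 0 else 1 := by
    intro y
    rw [Finset.prod_mul_distrib]
    split_ifs with h
    · have : ∏ j, (if j = i ∧ y j ≠ .erased then (0 : ℝ) else 1) = 1 := by
        refine Finset.prod_eq_one fun j _ => if_neg ?_
        rintro ⟨rfl, hj⟩
        exact hj h
      rw [this, mul_one]
    · have : ∏ j, (if j = i ∧ y j ≠ .erased then (0 : ℝ) else 1) = 0 :=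
        Finset.prod_eq_zero (Finset.mem_univ i) (by simp [h])
      rw [this, mul_zero]
  unfold FiniteChannel.wordProb
  rw [Finset.sum_congr rfl fun y _ => by convert h y]
  rw [Finset.sum_univ_prod_apply fun j v =>
    (receiverChannel h1 hq).prob (x j) v * if j = i ∧ v ≠ .erased then 0 else 1]
  rw [Finset.prod_eq_single i]
  · rw [receiverChannel_one_prob]
    simp [tildeErasure]
  · intro j _ hj
    simp [hj, (receiverChannel h1 hq).sum_one]
  · simp

theorem wordProb_and_add_and_not (x : Fin n → Bool) (E F : (Fin n → ErasureOutput) → Prop) :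
    (receiverChannel h1 hq).wordProb x (fun y => E y ∧ F y) +
      (receiverChannel h1 hq).wordProb x (fun y => E y ∧ ¬ F y) =
      (receiverChannel h1 hq).wordProb x E := by
  unfold FiniteChannel.wordProb
  rw [← Finset.sum_add_distrib]
  refine Finset.sum_congr rfl fun y _ => ?_
  by_cases hE : E y <;> by_cases hF : F y <;> simp [hE, hF]

theorem wordProb_and_erased_update (x : Fin n → Bool) (i : Fin n) (b : Bool)
    (E : (Fin n → ErasureOutput) → Prop) :
    (receiverChannel h1 hq).wordProb (Function.update x i b) (fun y => E y ∧ y i = .erased) =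
      (receiverChannel h1 hq).wordProb x (fun y => E y ∧ y i = .erased) := by
  refine Finset.sum_congr rfl fun y _ => ?_
  by_cases h : E y ∧ y i = .erased
  · rw [if_pos h, if_pos h, receiverChannel_one_prob]
    refine Finset.prod_congr rfl fun j _ => ?_
    by_cases hj : j = i
    · subst hj
      simp [h.2, tildeErasure]
    · rw [Function.update_of_ne hj]
  · rw [if_neg h, if_neg h]

/-- By independence both products are probabilities of joint events with `y i` unerased and `z i`
erased, one with `gB y = d` and the other with `gC z = d`. The two events differ only where the
decisions differ. -/
theorem abs_wordProb_sub_le_condProb (x : Fin n → Bool) {D : Type}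
    (gB gC : (Fin n → ErasureOutput) → D) (d : D) (i : Fin n) :
    |(receiverChannel h1 hq).wordProb x (fun y => gB y = d ∧ ¬ y i = .erased) * q -
      (1 - q) * (receiverChannel h1 hq).wordProb x (fun z => gC z = d ∧ z i = .erased)| ≤
      (twoStepErasure 1 q h1 hq).condProb x (fun y z => gB y ≠ gC z) := by
  have he := wordProb_erased h1 hq x i
  have hne : (receiverChannel h1 hq).wordProb x (fun y => ¬ y i = .erased) = 1 - q := by
    have := wordProb_and_add_and_not h1 hq x (fun _ => True) (fun y => y i = .erased)
    simp only [true_and, he, FiniteChannel.wordProb_true] at this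
    linarith
  rw [← hne]
  nth_rewrite 2 [← he]
  unfold FiniteChannel.wordProb
  rw [Finset.sum_mul_sum, Finset.sum_mul_sum, ← Finset.sum_sub_distrib]
  refine (Finset.abs_sum_le_sum_abs _ _).trans (Finset.sum_le_sum fun y _ => ?_)
  rw [← Finset.sum_sub_distrib]
  refine (Finset.abs_sum_le_sum_abs _ _).trans (Finset.sum_le_sum fun z _ => ?_)
  rw [blockProb_one]
  have hy := (receiverChannel h1 hq).word_nonneg x y
  have hz := (receiverChannel h1 hq).word_nonneg x z
  have hyz := mul_nonneg hy hz
  by_cases a : y i = .erased <;> by_cases b : z i = .erased <;>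
    by_cases hB : gB y = d <;> by_cases hC : gC z = d <;> by_cases hBC : gB y = gC z <;>
    simp_all [abs_of_nonneg]

/-- The part of each probability with letter `i` erased ignores input bit `i`. Hence B's erased part
cancels, and B's unerased part is compared, before and after the flip, with the same quantity of C;
this costs `η / q` twice. -/
theorem abs_wordProb_update_sub_le {D : Type} (gB gC : (Fin n → ErasureOutput) → D) (d : D) {η : ℝ}
    (hη : ∀ x, (twoStepErasure 1 q h1 hq).condProb x (fun y z => gB y ≠ gC z) ≤ η)
    (x : Fin n → Bool) (i : Fin n) (b : Bool) :
    |(receiverChannel h1 hq).wordProb (Function.update x i b) (fun y => gB y = d) -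
      (receiverChannel h1 hq).wordProb x (fun y => gB y = d)| ≤ 2 * η / q := by
  have hA := (abs_wordProb_sub_le_condProb h1 hq x gB gC d i).trans (hη x)
  have hA' := (abs_wordProb_sub_le_condProb h1 hq (Function.update x i b) gB gC d i).trans (hη _)
  rw [wordProb_and_erased_update] at hA'
  have s := wordProb_and_add_and_not h1 hq x (fun y => gB y = d) (fun y => y i = .erased)
  have s' := wordProb_and_add_and_not h1 hq (Function.update x i b) (fun y => gB y = d)
    (fun y => y i = .erased)
  rw [wordProb_and_erased_update] at s'
  rw [← s, ← s', add_sub_add_left_eq_sub]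
  rw [abs_le] at hA hA' ⊢
  rw [neg_div', div_le_iff₀ hq.1, le_div_iff₀ hq.1]
  constructor <;> linarith

theorem one_div_le_errorProb {K : ℕ} (hK : 2 ≤ K)
    (c : ConsensusCode Bool ErasureOutput ErasureOutput n K) :
    1 / (2 + (n : ℝ) * (2 / q)) ≤ c.errorProb (twoStepErasure 1 q h1 hq) := by
  set P := c.errorProb (twoStepErasure 1 q h1 hq) with hP
  set m₀ : Fin K := ⟨0, by omega⟩
  set m₁ : Fin K := ⟨1, by omega⟩
  have hne : m₁ ≠ m₀ := by simp [m₀, m₁]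
  have hosc := abs_sub_le_of_update
    (fun x => (receiverChannel h1 hq).wordProb x fun y => c.decB y = some m₀)
    (abs_wordProb_update_sub_le h1 hq c.decB c.decC (some m₀)
      fun x => c.disagreement_le_errorProb (twoStepErasure 1 q h1 hq) x) (c.enc m₁) (c.enc m₀)
  have ha := c.one_sub_errorProb_le (twoStepErasure 1 q h1 hq) m₀
  have hb := c.one_sub_errorProb_le (twoStepErasure 1 q h1 hq) m₁
  rw [marginalY_eq] at ha hb
  have hs := wordProb_and_add_and_not h1 hq (c.enc m₁) (fun _ => True)
    (fun y => c.decB y = some m₀)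
  simp only [true_and, FiniteChannel.wordProb_true] at hs
  have hmono := (receiverChannel h1 hq).wordProb_mono (c.enc m₁) (E := fun y => c.decB y = some m₁)
    (E' := fun y => ¬ c.decB y = some m₀) fun y hy h => hne (by
      rw [hy] at h; exact Option.some.inj h)
  have hle := (le_abs_self _).trans hosc
  have hq0 := hq.1
  rw [div_le_iff₀ (by positivity)]
  have : (n : ℝ) * (2 * P / q) = P * (n * (2 / q)) := by ring
  rw [← hP] at ha hb
  linarith
end

/-! ### Hamming balls and packings -/

theorem pow_hammingDist {n : ℕ} (α : ℝ) (x u : Fin n → Bool) :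
    α ^ hammingDist x u = ∏ i, if x i ≠ u i then α else 1 := by
  rw [hammingDist, Finset.prod_ite, Finset.prod_const, Finset.prod_const_one, mul_one]

theorem card_hammingBall_le {n : ℕ} (x : Fin n → Bool) (D : ℕ) {α : ℝ} (h0 : 0 < α) (h1 : α ≤ 1) :
    ((Finset.univ.filter fun u => hammingDist x u ≤ D).card : ℝ) ≤ (1 + α) ^ n / α ^ D := by
  rw [Finset.card_filter]
  push_cast
  rw [le_div_iff₀ (by positivity), Finset.sum_mul]
  calc _ ≤ ∑ u : Fin n → Bool, ∏ i, (if x i ≠ u i then α else 1) := by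
        refine Finset.sum_le_sum fun u _ => ?_
        rw [← pow_hammingDist]
        split_ifs with h
        · rw [one_mul]
          exact pow_le_pow_of_le_one h0.le h1 h
        · rw [zero_mul]
          positivity
    _ = (1 + α) ^ n := by
        rw [Finset.sum_univ_prod_apply fun i (b : Bool) => if x i ≠ b then α else 1]
        have : ∀ i, ∑ b : Bool, (if x i ≠ b then α else 1) = 1 + α := by
          intro i
          cases x i <;> simp [add_comm]
        rw [Finset.prod_congr rfl fun i _ => this i]
        simp

/-- The Gilbert–Varshamov bound. -/
theorem exists_packing (n D : ℕ) {α : ℝ} (h0 : 0 < α) (h1 : α ≤ 1) :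
    ∃ C : Finset (Fin n → Bool), (∀ u ∈ C, ∀ v ∈ C, u ≠ v → D < hammingDist u v) ∧
      (2 : ℝ) ^ n ≤ C.card * ((1 + α) ^ n / α ^ D) := by
  classical
  let S : Finset (Finset (Fin n → Bool)) :=
    Finset.univ.filter fun C => ∀ u ∈ C, ∀ v ∈ C, u ≠ v → D < hammingDist u v
  obtain ⟨C, hC⟩ := S.exists_maximal ⟨∅, by simp [S]⟩
  have hsep : ∀ u ∈ C, ∀ v ∈ C, u ≠ v → D < hammingDist u v := by
    simpa [S] using hC.prop
  refine ⟨C, hsep, ?_⟩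
  -- A word outside all balls could be added to the maximal packing.
  have hcover : (Finset.univ : Finset (Fin n → Bool)) ⊆
      C.biUnion fun u => Finset.univ.filter fun v => hammingDist u v ≤ D := by
    intro v _
    by_contra hv
    simp only [Finset.mem_biUnion, Finset.mem_filter, Finset.mem_univ, true_and, not_exists,
      not_and, not_le] at hv
    have hins : insert v C ∈ S := by
      simp only [S, Finset.mem_filter, Finset.mem_univ, true_and, Finset.mem_insert]
      rintro u (rfl | hu) w (rfl | hw) hne
      · exact absurd rfl hne
      · rw [hammingDist_comm]; exact hv w hw
      · exact hv u hu
      · exact hsep u hu w hw hne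
    have hvC : v ∈ C := hC.le_of_ge hins (Finset.subset_insert v C) (Finset.mem_insert_self v C)
    have := hv v hvC
    simp at this
  have hcard := (Finset.card_le_card hcover).trans Finset.card_biUnion_le
  rw [Finset.card_univ, Fintype.card_fun, Fintype.card_bool, Fintype.card_fin] at hcard
  calc (2 : ℝ) ^ n ≤ ∑ u ∈ C, ((Finset.univ.filter fun v => hammingDist u v ≤ D).card : ℝ) := by
        exact_mod_cast hcard
    _ ≤ ∑ _u ∈ C, (1 + α) ^ n / α ^ D := Finset.sum_le_sum fun u _ => card_hammingBall_le u D h0 h1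
    _ = _ := by rw [Finset.sum_const, nsmul_eq_mul]

theorem Real.exp_le_one_add_two_mul {t : ℝ} (h0 : 0 ≤ t) (h1 : t ≤ 1) :
    Real.exp t ≤ 1 + 2 * t := by
  have h := Real.abs_exp_sub_one_sub_id_le (x := t) (by rwa [abs_of_nonneg h0])
  have := (abs_le.1 h).2
  nlinarith

/-! ### Random selection with a union bound -/

/-- Choosing one representative from each of `K` blocks of size `B` at random: some choice keeps,
for every index `x`, the sum of the weights within twice its mean plus `a * t`. -/
theorem exists_selection {X : Type} [Fintype X] {K B : ℕ} (hB : 0 < B)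
    (w : X → Fin K → Fin B → ℝ) {a S t : ℝ} (ha : 0 < a) (hw0 : ∀ x m b, 0 ≤ w x m b)
    (hwa : ∀ x m b, w x m b ≤ a) (hS : ∀ x, ∑ m, ∑ b, w x m b ≤ S)
    (ht : (Fintype.card X : ℝ) < Real.exp t) :
    ∃ s : Fin K → Fin B, ∀ x, ∑ m, w x m (s m) ≤ 2 * S / B + a * t := by
  have hB' : (0 : ℝ) < B := by exact_mod_cast hB
  by_contra! hcon
  have hmgf : ∀ x, ∑ s : Fin K → Fin B, Real.exp ((∑ m, w x m (s m)) / a) ≤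
      (B : ℝ) ^ K * Real.exp (2 * S / B / a) := by
    intro x
    -- The bound `exp t ≤ 1 + 2 * t` on `[0, 1]` is the source of the factor `2` before the mean.
    have hblock : ∀ m, ∑ b, Real.exp (w x m b / a) ≤
        B * Real.exp (2 / B / a * ∑ b, w x m b) := by
      intro m
      calc ∑ b, Real.exp (w x m b / a) ≤ ∑ b, (1 + 2 * (w x m b / a)) :=
            Finset.sum_le_sum fun b _ => Real.exp_le_one_add_two_mul
              (div_nonneg (hw0 x m b) ha.le) ((div_le_one ha).2 (hwa x m b))
        _ = B * (2 / B / a * ∑ b, w x m b + 1) := by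
            rw [Finset.sum_add_distrib, ← Finset.mul_sum, ← Finset.sum_div]
            simp
            field_simp
            ring
        _ ≤ _ := by
            gcongr
            exact Real.add_one_le_exp _
    calc _ = ∑ s : Fin K → Fin B, ∏ m, Real.exp (w x m (s m) / a) := by
          refine Finset.sum_congr rfl fun s _ => ?_
          rw [Finset.sum_div, Real.exp_sum]
      _ = ∏ m, ∑ b, Real.exp (w x m b / a) :=
          Finset.sum_univ_prod_apply fun m b => Real.exp (w x m b / a)
      _ ≤ ∏ m : Fin K, (B * Real.exp (2 / B / a * ∑ b, w x m b)) :=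
          Finset.prod_le_prod (fun m _ => Finset.sum_nonneg fun b _ => (Real.exp_pos _).le)
            fun m _ => hblock m
      _ = (B : ℝ) ^ K * Real.exp (2 / B / a * ∑ m, ∑ b, w x m b) := by
          rw [Finset.prod_mul_distrib, ← Real.exp_sum, ← Finset.mul_sum]
          simp
      _ ≤ _ := by
          gcongr
          calc _ ≤ 2 / B / a * S := by
                gcongr
                exact hS x
            _ = _ := by ring
  -- If every selection failed at some `x`, the double sum would be at least `exp t` times the bound
  -- `hmgf` for a single `x`, against `Fintype.card X < exp t`.
  have hlow : (B : ℝ) ^ K * Real.exp (2 * S / B / a + t) ≤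
      ∑ s : Fin K → Fin B, ∑ x, Real.exp ((∑ m, w x m (s m)) / a) := by
    calc _ = ∑ _s : Fin K → Fin B, Real.exp (2 * S / B / a + t) := by simp
      _ ≤ _ := by
          refine Finset.sum_le_sum fun s _ => ?_
          obtain ⟨x, hx⟩ := hcon s
          refine le_trans ?_ (Finset.single_le_sum
            (f := fun x => Real.exp ((∑ m, w x m (s m)) / a)) (fun x _ => (Real.exp_pos _).le)
            (Finset.mem_univ x))
          rw [Real.exp_le_exp, le_div_iff₀ ha, add_mul, div_mul_cancel₀ _ ha.ne', mul_comm t]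
          exact hx.le
  rw [Finset.sum_comm] at hlow
  have hup := Finset.sum_le_sum fun x (_ : x ∈ (Finset.univ : Finset X)) => hmgf x
  rw [Finset.sum_const, Finset.card_univ, nsmul_eq_mul] at hup
  have := hlow.trans hup
  rw [Real.exp_add] at this
  have hpos : 0 < (B : ℝ) ^ K * Real.exp (2 * S / B / a) := by positivity
  nlinarith

/-! ### The acceptance code and its error probability -/

/-- The acceptance rule of a receiver: enough letters are not erased, the untilded letters agree
with `u`, and at most `D` tilded letters disagree with `u`. -/
structure Accepts {n : ℕ} (τ : ℝ) (D : ℕ) (y : Fin n → ErasureOutput) (u : Fin n → Bool) :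
    Prop where
  unerased_ge : n * τ ≤ unerased y
  plain_ne : ∀ i, y i ≠ .plain (!u i)
  tilde_le : (Finset.univ.filter fun i => y i = .tilde (!u i)).card ≤ D

open Classical in
-- An erasure leaves the bit of `u` free and an untilded letter fixes it. A tilded letter fixes it
-- up to the allowed mismatches, which are counted with the weight `α` and normalised by `α ^ D`.
theorem card_accepts_le {n : ℕ} (τ : ℝ) (D : ℕ) {α : ℝ} (h0 : 0 < α) (h1 : α ≤ 1)
    (y : Fin n → ErasureOutput) :
    ((Finset.univ.filter fun u => Accepts τ D y u).card : ℝ) ≤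
      (2 : ℝ) ^ (n * (1 - τ)) * ((1 + α) ^ n / α ^ D) := by
  by_cases hk : n * τ ≤ unerased y
  swap
  · have : (Finset.univ.filter fun u => Accepts τ D y u) = ∅ :=
      Finset.filter_eq_empty_iff.2 fun u _ h => hk h.unerased_ge
    rw [this]
    simp only [Finset.card_empty, Nat.cast_zero]
    positivity
  rw [Finset.card_filter]
  push_cast
  rw [← mul_div_assoc, le_div_iff₀ (by positivity), Finset.sum_mul]
  set F : Fin n → Bool → ℝ := fun i b =>
    if y i = .plain (!b) then 0 else if y i = .tilde (!b) then α else 1 with hF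
  have hF0 : ∀ i b, 0 ≤ F i b := fun i b => by
    simp only [hF]
    split_ifs <;> positivity
  calc _ ≤ ∑ u : Fin n → Bool, ∏ i, F i (u i) := by
        refine Finset.sum_le_sum fun u _ => ?_
        split_ifs with h
        · have : ∏ i, F i (u i) =
              α ^ (Finset.univ.filter fun i => y i = .tilde (!u i)).card := by
            rw [← Finset.prod_const, Finset.prod_filter]
            exact Finset.prod_congr rfl fun i _ => by simp only [hF, if_neg (h.plain_ne i)]
          rw [one_mul, this]
          exact pow_le_pow_of_le_one h0.le h1 h.tilde_le
        · rw [zero_mul]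
          exact Finset.prod_nonneg fun i _ => hF0 i _
    _ = ∏ i, ∑ b, F i b := Finset.sum_univ_prod_apply F
    _ ≤ ∏ i, (2 : ℝ) ^ (1 - if y i = .erased then (0 : ℝ) else 1) * (1 + α) := by
        refine Finset.prod_le_prod (fun i _ => Finset.sum_nonneg fun b _ => hF0 i b) fun i _ => ?_
        rw [Fintype.sum_bool]
        rcases hy : y i with (_ | _) | (_ | _) | _ <;> simp [hF, hy] <;> linarith
    _ = (2 : ℝ) ^ (n - unerased y : ℝ) * (1 + α) ^ n := by
        rw [Finset.prod_mul_distrib, ← Real.rpow_sum_of_pos two_pos, Finset.sum_sub_distrib,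
          ← unerased_eq_sum]
        simp
    _ ≤ _ := by
        gcongr
        · norm_num
        · linarith

section
variable {p q : ℝ} (hp : p ∈ Set.Icc (0 : ℝ) 1) (hq : q ∈ Set.Ioc (0 : ℝ) 1) {n : ℕ}

theorem sum_wordProb_accepts_le (τ : ℝ) (D : ℕ) {α : ℝ} (h0 : 0 < α) (h1 : α ≤ 1)
    (x : Fin n → Bool) :
    ∑ u, (receiverChannel hp hq).wordProb x (fun y => Accepts τ D y u) ≤
      (2 : ℝ) ^ (n * (1 - τ)) * ((1 + α) ^ n / α ^ D) := by
  classical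
  unfold FiniteChannel.wordProb
  rw [Finset.sum_comm]
  calc _ ≤ ∑ y : Fin n → ErasureOutput, (∏ i, (receiverChannel hp hq).prob (x i) (y i)) *
        ((2 : ℝ) ^ (n * (1 - τ)) * ((1 + α) ^ n / α ^ D)) := by
        refine Finset.sum_le_sum fun y _ => ?_
        refine le_trans (le_of_eq ?_) (mul_le_mul_of_nonneg_left (card_accepts_le τ D h0 h1 y)
          ((receiverChannel hp hq).word_nonneg x y))
        rw [← Finset.sum_filter, Finset.sum_const, nsmul_eq_mul, mul_comm]
    _ = _ := by
        rw [← Finset.sum_mul, Finset.sum_univ_prod_apply fun i =>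
          (receiverChannel hp hq).prob (x i)]
        simp [(receiverChannel hp hq).sum_one]

/-- At each position where `x` and `u` differ, an untilded letter would refute `u`; it is absent
with probability `p`. -/
theorem wordProb_accepts_le (τ : ℝ) (D : ℕ) (x u : Fin n → Bool) :
    (receiverChannel hp hq).wordProb x (fun y => Accepts τ D y u) ≤ p ^ hammingDist x u := by
  refine (FiniteChannel.wordProb_le_prod _ x _
    (fun i v => if v = .plain (!u i) then 0 else 1) (fun i v => by split_ifs <;> norm_num)
    fun y hy => ?_).trans_eq ?_
  · rw [Finset.prod_congr rfl fun i _ => if_neg (hy.plain_ne i)]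
    simp
  · rw [pow_hammingDist]
    refine Finset.prod_congr rfl fun i _ => ?_
    rw [receiverChannel_prob]
    cases x i <;> cases u i <;>
      simp [ErasureOutput.sum_eq, receiverProb, tildeErasure] <;> ring
end

section
variable {p q : ℝ} {n K : ℕ}

theorem plain_iff_of_twoStepProb_ne_zero {x : Bool} {y z : ErasureOutput}
    (h : twoStepProb p q x y z ≠ 0) (b : Bool) : y = .plain b ↔ z = .plain b := by
  rcases y with c | c | _ <;> rcases z with d | d | _ <;>
    simp_all [twoStepProb, tildeErasure]

theorem plain_eq_of_twoStepProb_ne_zero {x : Bool} {y z : ErasureOutput} {b : Bool}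
    (h : twoStepProb p q x y z ≠ 0) (hy : y = .plain b) : b = x := by
  subst hy
  by_contra hb
  simp [twoStepProb, tildeErasure, hb] at h

theorem tilde_eq_of_twoStepProb_ne_zero {x : Bool} {y z : ErasureOutput} {b : Bool}
    (h : twoStepProb p q x y z ≠ 0) (hy : y = .tilde b) : b = x := by
  subst hy
  by_contra hb
  simp [twoStepProb, tildeErasure, hb] at h

theorem card_tilde_le {y : Fin n → ErasureOutput} {x : Fin n → Bool}
    (ht : ∀ i b, y i = .tilde b → b = x i) (u : Fin n → Bool) :
    (Finset.univ.filter fun i => y i = .tilde (!u i)).card ≤ hammingDist x u := by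
  refine Finset.card_le_card fun i hi => ?_
  simp only [Finset.mem_filter, Finset.mem_univ, true_and] at hi ⊢
  rw [← ht i _ hi]
  simp

theorem Accepts.transfer {τ : ℝ} {D : ℕ} {y z : Fin n → ErasureOutput} {x u : Fin n → Bool}
    (h : Accepts τ D y u) (hpl : ∀ i b, y i = .plain b ↔ z i = .plain b)
    (ht : ∀ i b, z i = .tilde b → b = x i) (hk : n * τ ≤ unerased z)
    (hd : hammingDist x u ≤ D) : Accepts τ D z u :=
  ⟨hk, fun i hi => h.plain_ne i ((hpl i _).2 hi), (card_tilde_le ht u).trans hd⟩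

open Classical in
/-- The messages whose codewords are accepted by a receiver. -/
noncomputable def acceptedMessages (f : Fin K → Fin n → Bool) (τ : ℝ) (D : ℕ)
    (y : Fin n → ErasureOutput) : Finset (Fin K) :=
  Finset.univ.filter fun m => Accepts τ D y (f m)

/-- The code in which both receivers decode to some accepted message. -/
noncomputable def acceptanceCode (f : Fin K → Fin n → Bool) (τ : ℝ) (D : ℕ) :
    ConsensusCode Bool ErasureOutput ErasureOutput n K where
  enc := f
  -- Any choice depending only on the set would do: equal sets give equal decisions, and the empty
  -- set gives `⊥`.
  decB y := (acceptedMessages f τ D y).toList.head?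
  decC z := (acceptedMessages f τ D z).toList.head?

/-- The receiver sees too many erasures or accepts a codeword far from the channel input. -/
def Misled (f : Fin K → Fin n → Bool) (τ : ℝ) (D : ℕ) (x : Fin n → Bool)
    (y : Fin n → ErasureOutput) : Prop :=
  (unerased y : ℝ) < n * τ ∨ ∃ m, D < hammingDist x (f m) ∧ Accepts τ D y (f m)

theorem acceptedMessages_subset {f : Fin K → Fin n → Bool} {τ : ℝ} {D : ℕ} {x : Fin n → Bool}
    {y z : Fin n → ErasureOutput} (hpl : ∀ i b, y i = .plain b ↔ z i = .plain b)
    (ht : ∀ i b, z i = .tilde b → b = x i) (hy : ¬ Misled f τ D x y) (hz : ¬ Misled f τ D x z) :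
    acceptedMessages f τ D y ⊆ acceptedMessages f τ D z := by
  intro m hm
  simp only [acceptedMessages, Finset.mem_filter, Finset.mem_univ, true_and] at hm ⊢
  simp only [Misled, not_or, not_lt, not_exists, not_and] at hy hz
  exact hm.transfer hpl ht hz.1 (not_lt.1 fun hd => hy.2 m hd hm)

theorem acceptedMessages_eq_singleton {f : Fin K → Fin n → Bool} {τ : ℝ} {D : ℕ} {m : Fin K}
    {y : Fin n → ErasureOutput} (hf : ∀ m', m' ≠ m → D < hammingDist (f m) (f m'))
    (hpl : ∀ i b, y i = .plain b → b = f m i) (ht : ∀ i b, y i = .tilde b → b = f m i)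
    (hy : ¬ Misled f τ D (f m) y) : acceptedMessages f τ D y = {m} := by
  simp only [Misled, not_or, not_lt, not_exists, not_and] at hy
  ext m'
  simp only [acceptedMessages, Finset.mem_filter, Finset.mem_univ, true_and,
    Finset.mem_singleton]
  constructor
  · intro h
    by_contra hne
    exact hy.2 m' (hf m' hne) h
  · rintro rfl
    refine ⟨hy.1, fun i hi => ?_, (card_tilde_le ht _).trans (by simp)⟩
    have := hpl i _ hi
    simp at this

variable (hp : p ∈ Set.Icc (0 : ℝ) 1) (hq : q ∈ Set.Ioc (0 : ℝ) 1)

theorem condProb_misled_le (f : Fin K → Fin n → Bool) (τ : ℝ) (D : ℕ) (x : Fin n → Bool) :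
    (twoStepErasure p q hp hq).condProb x (fun y z => Misled f τ D x y ∨ Misled f τ D x z) ≤
      2 * (receiverChannel hp hq).wordProb x (Misled f τ D x) := by
  have h := (twoStepErasure p q hp hq).condProb_or_le x (fun y _ => Misled f τ D x y)
    fun _ z => Misled f τ D x z
  rw [BroadcastChannel.condProb_fst, BroadcastChannel.condProb_snd, marginalY_eq,
    marginalZ_eq] at h
  linarith

/-- Unless one of the receivers is misled, the two accept the same set of messages, and for a
codeword as input that set is a singleton. The factor `2` counts the receivers. -/
theorem errorProb_acceptanceCode_le {f : Fin K → Fin n → Bool} {τ : ℝ} {D : ℕ} {β : ℝ}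
    (hf : ∀ m m', m' ≠ m → D < hammingDist (f m) (f m')) (hβ0 : 0 ≤ β)
    (hβ : ∀ x, (receiverChannel hp hq).wordProb x (Misled f τ D x) ≤ β) :
    (acceptanceCode f τ D).errorProb (twoStepErasure p q hp hq) ≤ 2 * β := by
  set W := twoStepErasure p q hp hq with hW
  have hsupp : ∀ {x y z}, W.blockProb x y z ≠ 0 →
      ∀ i : Fin n, twoStepProb p q (x i) (y i) (z i) ≠ 0 :=
    fun h i => Finset.prod_ne_zero_iff.1 h i (Finset.mem_univ i)
  have hbound : ∀ x : Fin n → Bool,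
      W.condProb x (fun y z => Misled f τ D x y ∨ Misled f τ D x z) ≤ 2 * β := fun x =>
    (condProb_misled_le hp hq f τ D x).trans (by linarith [hβ x])
  refine ConsensusCode.errorProb_le _ _ (by linarith) (fun m => ?_) fun x => ?_
  · refine le_trans ?_ (hbound (f m))
    have h1 := W.condProb_add_not (f m) fun y z =>
      (acceptanceCode f τ D).decB y = some m ∧ (acceptanceCode f τ D).decC z = some m
    have h2 := W.condProb_mono (f m)
      (E := fun y z => ¬((acceptanceCode f τ D).decB y = some m ∧
        (acceptanceCode f τ D).decC z = some m))
      (E' := fun y z => Misled f τ D (f m) y ∨ Misled f τ D (f m) z) (by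
        intro y z h hE
        by_contra! hn
        refine hE ⟨?_, ?_⟩
        · simp [acceptanceCode, acceptedMessages_eq_singleton (hf m)
            (fun i b => plain_eq_of_twoStepProb_ne_zero (hsupp h i))
            (fun i b => tilde_eq_of_twoStepProb_ne_zero (hsupp h i)) hn.1]
        · simp [acceptanceCode, acceptedMessages_eq_singleton (hf m)
            (fun i b => plain_eq_of_twoStepProb_ne_zero
              (twoStepProb_comm p q _ _ _ ▸ hsupp h i))
            (fun i b => tilde_eq_of_twoStepProb_ne_zero
              (twoStepProb_comm p q _ _ _ ▸ hsupp h i)) hn.2])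
    change 1 - W.condProb (f m) _ ≤ _
    linarith
  · refine le_trans (W.condProb_mono x fun y z h hE => ?_) (hbound x)
    by_contra! hn
    refine hE ?_
    have : acceptedMessages f τ D y = acceptedMessages f τ D z := by
      apply Finset.Subset.antisymm
      · exact acceptedMessages_subset (fun i => plain_iff_of_twoStepProb_ne_zero (hsupp h i))
          (fun i b => tilde_eq_of_twoStepProb_ne_zero
            (twoStepProb_comm p q _ _ _ ▸ hsupp h i)) hn.1 hn.2
      · exact acceptedMessages_subset
          (fun i b => (plain_iff_of_twoStepProb_ne_zero (hsupp h i) b).symm)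
          (fun i b => tilde_eq_of_twoStepProb_ne_zero (hsupp h i)) hn.2 hn.1
    simp [acceptanceCode, this]

theorem exists_consensusCode {B D : ℕ} (hB : 0 < B) {τ α a γ : ℝ} (hα0 : 0 < α) (hα1 : α ≤ 1)
    (ha : 0 < a) (hpa : p ^ (D + 1) ≤ a) {C : Finset (Fin n → Bool)}
    (hC : ∀ u ∈ C, ∀ v ∈ C, u ≠ v → D < hammingDist u v) (hKB : K * B ≤ C.card) (hγ0 : 0 ≤ γ)
    (hγ : ∀ x : Fin n → Bool,
      (receiverChannel hp hq).wordProb x (fun y => (unerased y : ℝ) < n * τ) ≤ γ ^ n) :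
    ∃ c : ConsensusCode Bool ErasureOutput ErasureOutput n K,
      c.errorProb (twoStepErasure p q hp hq) ≤ 2 * (γ ^ n +
        (2 * ((2 : ℝ) ^ (n * (1 - τ)) * ((1 + α) ^ n / α ^ D)) / B + a * (n + 1))) := by
  classical
  obtain ⟨e⟩ : Nonempty ((Fin K × Fin B) ↪ C) :=
    Function.Embedding.nonempty_of_card_le (by simpa using hKB)
  set u : Fin K × Fin B ↪ (Fin n → Bool) := e.trans (Function.Embedding.subtype _) with hu
  have huC : ∀ k, u k ∈ C := fun k => (e k).2
  set g : (Fin n → Bool) → (Fin n → Bool) → ℝ := fun x v =>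
    (receiverChannel hp hq).wordProb x (fun y => Accepts τ D y v) with hg
  have hg0 : ∀ x v, 0 ≤ g x v := fun x v => FiniteChannel.wordProb_nonneg _ _ _
  -- Only far codewords get weight. Each weight is at most `p ^ (D + 1)`, and since the `u (m, b)`
  -- are distinct, their sum is bounded by the expected number of accepted words. The choice `t = n
  -- + 1` serves `2 ^ n < exp (n + 1)`.
  obtain ⟨s, hs⟩ := exists_selection hB
    (fun (x : Fin n → Bool) m b => if D < hammingDist x (u (m, b)) then g x (u (m, b)) else 0)
    (S := (2 : ℝ) ^ (n * (1 - τ)) * ((1 + α) ^ n / α ^ D)) (t := n + 1) ha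
    (fun x m b => by
      split_ifs
      exacts [hg0 _ _, le_rfl])
    (fun x m b => by
      split_ifs with h
      · exact ((wordProb_accepts_le hp hq τ D x _).trans
          (pow_le_pow_of_le_one hp.1 hp.2 h)).trans hpa
      · exact ha.le)
    (fun x => by
      refine le_trans ?_ (sum_wordProb_accepts_le hp hq τ D hα0 hα1 x)
      rw [← Fintype.sum_prod_type' (f := fun m b =>
        if D < hammingDist x (u (m, b)) then g x (u (m, b)) else 0)]
      calc _ ≤ ∑ k, g x (u k) := Finset.sum_le_sum fun k _ => by
            split_ifs
            exacts [le_rfl, hg0 _ _]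
        _ = ∑ v ∈ Finset.univ.map u, g x v := (Finset.sum_map _ _ _).symm
        _ ≤ _ := Finset.sum_le_sum_of_subset_of_nonneg (Finset.subset_univ _)
            fun v _ _ => hg0 x v)
    (by
      rw [Fintype.card_fun, Fintype.card_bool, Fintype.card_fin]
      push_cast
      calc (2 : ℝ) ^ n ≤ Real.exp 1 ^ n := by
            gcongr
            linarith [Real.add_one_le_exp (1 : ℝ)]
        _ = Real.exp n := by rw [← Real.exp_nat_mul, mul_one]
        _ < _ := Real.exp_lt_exp.2 (by linarith))
  have hS0 : 0 ≤ (2 : ℝ) ^ (n * (1 - τ)) * ((1 + α) ^ n / α ^ D) := by positivity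
  refine ⟨acceptanceCode (fun m => u (m, s m)) τ D,
    errorProb_acceptanceCode_le hp hq (fun m m' hne => ?_) (by positivity) fun x => ?_⟩
  · refine hC _ (huC _) _ (huC _) fun h => hne ?_
    exact (Prod.ext_iff.1 (u.injective h)).1.symm
  · have h1 := (receiverChannel hp hq).wordProb_or_le x (fun y => (unerased y : ℝ) < n * τ)
      fun y => ∃ m, D < hammingDist x (u (m, s m)) ∧ Accepts τ D y (u (m, s m))
    have h2 := (receiverChannel hp hq).wordProb_exists_le x
      fun m y => D < hammingDist x (u (m, s m)) ∧ Accepts τ D y (u (m, s m))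
    have h3 : ∑ m, (receiverChannel hp hq).wordProb x
        (fun y => D < hammingDist x (u (m, s m)) ∧ Accepts τ D y (u (m, s m))) =
        ∑ m, if D < hammingDist x (u (m, s m)) then g x (u (m, s m)) else 0 := by
      refine Finset.sum_congr rfl fun m _ => ?_
      split_ifs with h
      · simp [hg, h]
      · simp [h, FiniteChannel.wordProb]
    have h4 := hs x
    change (receiverChannel hp hq).wordProb x (fun y => _ ∨ _) ≤ _
    linarith [hγ x]

/-! ### Choice of parameters and achievability for `p < 1` -/

/-- Parameters for which Hamming balls of relative radius `δ` grow at rate at most `κ`. -/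
theorem exists_ball_parameters {κ : ℝ} (hκ : 0 < κ) :
    ∃ α δ : ℝ, 0 < α ∧ α ≤ 1 ∧ 0 < δ ∧
      ∀ n : ℕ, (1 + α) ^ n / α ^ ⌊δ * n⌋₊ ≤ (2 : ℝ) ^ (κ * n) := by
  have h2 : (1 : ℝ) < 2 ^ (κ / 2) := Real.one_lt_rpow one_lt_two (by linarith)
  obtain ⟨L, hL⟩ := exists_pow_lt_of_lt_one (sub_pos.2 h2) (show (1 / 2 : ℝ) < 1 by norm_num)
  have hα : (1 / 2 : ℝ) ^ (L + 1) < 2 ^ (κ / 2) - 1 :=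
    lt_of_le_of_lt (pow_le_pow_of_le_one (by norm_num) (by norm_num) (Nat.le_succ L)) hL
  have hL0 : (0 : ℝ) < (L + 1 : ℕ) := by positivity
  -- With `α = 2 ^ (-(L + 1))`, half of the rate `κ` pays for `(1 + α) ^ n`. The radius `δ` is
  -- chosen so that `α ^ (-D) = 2 ^ ((L + 1) * D)` uses at most the other half.
  refine ⟨(1 / 2) ^ (L + 1), κ / 2 / (L + 1 : ℕ), by positivity,
    pow_le_one₀ (by norm_num) (by norm_num), by positivity, fun n => ?_⟩
  set D := ⌊κ / 2 / (L + 1 : ℕ) * n⌋₊ with hD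
  have hDle : (D : ℝ) ≤ κ / 2 / (L + 1 : ℕ) * n := Nat.floor_le (by positivity)
  have h3 : (1 + (1 / 2 : ℝ) ^ (L + 1)) ^ n ≤ (2 : ℝ) ^ (κ / 2 * n) := by
    rw [Real.rpow_mul_natCast zero_le_two]
    gcongr
    linarith
  have h4 : ((1 / 2 : ℝ) ^ (L + 1)) ^ D = (2 : ℝ) ^ (-(((L + 1 : ℕ) : ℝ) * D)) := by
    rw [Real.rpow_neg zero_le_two, ← pow_mul, ← Nat.cast_mul, Real.rpow_natCast, one_div, inv_pow]
  have h5 : ((L + 1 : ℕ) : ℝ) * D ≤ κ / 2 * n := by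
    calc _ ≤ ((L + 1 : ℕ) : ℝ) * (κ / 2 / (L + 1 : ℕ) * n) := by gcongr
      _ = _ := by field_simp
  rw [h4, div_le_iff₀ (by positivity), ← Real.rpow_add two_pos]
  refine h3.trans (Real.rpow_le_rpow_of_exponent_le one_le_two ?_)
  linarith

theorem exists_rate_of_geometric {r : ℝ} (h0 : 0 < r) (h1 : r < 1) (a b : ℝ) :
    ∃ ε : ℝ, 0 < ε ∧ ∃ n₀ : ℕ, ∀ n : ℕ, n₀ ≤ n → (a * n + b) * r ^ n ≤ (2 : ℝ) ^ (-((n : ℝ) * ε)) := by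
  -- One factor `√r ^ n` absorbs the linear factor and the other gives the rate.
  have hs0 : 0 < √r := Real.sqrt_pos.2 h0
  have hs1 : √r < 1 := by
    rw [Real.sqrt_lt' one_pos]
    simpa using h1
  have ht : Filter.Tendsto (fun n : ℕ => a * (n * √r ^ n) + b * √r ^ n) Filter.atTop
      (nhds (a * 0 + b * 0)) :=
    ((tendsto_self_mul_const_pow_of_lt_one hs0.le hs1).const_mul a).add
      ((tendsto_pow_atTop_nhds_zero_of_lt_one hs0.le hs1).const_mul b)
  obtain ⟨n₀, hn₀⟩ := Filter.eventually_atTop.1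
    (ht.eventually_lt_const (show a * 0 + b * 0 < (1 : ℝ) by norm_num))
  refine ⟨-Real.logb 2 √r, neg_pos.2 (Real.logb_neg one_lt_two hs0 hs1), n₀, fun n hn => ?_⟩
  have h := hn₀ n hn
  have h2 : (2 : ℝ) ^ (-((n : ℝ) * -Real.logb 2 √r)) = √r ^ n := by
    rw [mul_neg, neg_neg, mul_comm, Real.rpow_mul_natCast zero_le_two,
      Real.rpow_logb two_pos (by norm_num) hs0]
  rw [h2]
  have h3 : r ^ n = √r ^ n * √r ^ n := by rw [← mul_pow, Real.mul_self_sqrt h0.le]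
  have hsn : 0 < √r ^ n := by positivity
  rw [h3]
  calc _ = (a * (n * √r ^ n) + b * √r ^ n) * √r ^ n := by ring
    _ ≤ 1 * √r ^ n := by gcongr
    _ = _ := one_mul _

theorem achievable_of_lt (hp1 : p < 1) {R : ℝ} (hR0 : 0 ≤ R) (hR : R < 1 - p * q) :
    (twoStepErasure p q hp hq).Achievable R := by
  have hpq : 0 ≤ p * q := mul_nonneg hp.1 hq.1.le
  obtain ⟨τ, hRτ, hτ⟩ := exists_between hR
  obtain ⟨γ, hγ0, hγ1, hγ⟩ := exists_unerased_lower_tail hp hq hτ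
  -- The mean weight has exponent `(1 - τ) + κ + R - (1 - κ) = -2 * κ`.
  set κ := (τ - R) / 4 with hκ
  have hκ0 : 0 < κ := by rw [hκ]; linarith
  obtain ⟨α, δ, hα0, hα1, hδ, hball⟩ := exists_ball_parameters hκ0
  -- This keeps the base of the real power positive when `p = 0`.
  set p' := max p (1 / 2) with hp'
  have hp'0 : 0 < p' := lt_max_of_lt_right (by norm_num)
  have hp'1 : p' < 1 := max_lt hp1 (by norm_num)
  set r := max γ (max ((2 : ℝ) ^ (-(2 * κ))) (p' ^ δ)) with hr
  have hrγ : γ ≤ r := le_max_left _ _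
  have hrκ : (2 : ℝ) ^ (-(2 * κ)) ≤ r := (le_max_left _ _).trans (le_max_right _ _)
  have hrδ : p' ^ δ ≤ r := (le_max_right _ _).trans (le_max_right _ _)
  have hr0 : 0 < r := lt_of_lt_of_le (by positivity) hrκ
  have hr1 : r < 1 := max_lt hγ1 (max_lt
    (Real.rpow_lt_one_of_one_lt_of_neg one_lt_two (by linarith))
    (Real.rpow_lt_one hp'0.le hp'1 hδ))
  -- The total error is at most `2 * (1 + 4 + (n + 1)) * r ^ n = (2 * n + 12) * r ^ n`.
  obtain ⟨ε, hε, n₀, hn₀⟩ := exists_rate_of_geometric hr0 hr1 2 12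
  refine ⟨ε, hε, n₀, fun n hn => ?_⟩
  obtain ⟨C, hCsep, hCcard⟩ := exists_packing n ⌊δ * n⌋₊ hα0 hα1
  set G := (1 + α) ^ n / α ^ ⌊δ * (n : ℝ)⌋₊ with hG
  have hG0 : 0 < G := by positivity
  have hGle : G ≤ (2 : ℝ) ^ (κ * n) := hball n
  obtain ⟨M, hM⟩ : ∃ M, M = (2 : ℝ) ^ ((n : ℝ) * R) := ⟨_, rfl⟩
  rw [← hM]
  have hM1 : 1 ≤ M := hM ▸ Real.one_le_rpow one_le_two (by positivity)
  set K := ⌊M⌋₊ with hK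
  have hK1 : 1 ≤ K := (Nat.one_le_floor_iff M).2 hM1
  have hKM : (K : ℝ) ≤ M := Nat.floor_le (by linarith)
  have hC2 : (2 : ℝ) ^ ((1 - κ) * n) ≤ C.card := by
    have h1 : (2 : ℝ) ^ n ≤ C.card * (2 : ℝ) ^ (κ * n) := hCcard.trans (by gcongr)
    have h2 : (2 : ℝ) ^ n = (2 : ℝ) ^ ((1 - κ) * n) * (2 : ℝ) ^ (κ * n) := by
      rw [← Real.rpow_add two_pos, ← Real.rpow_natCast]
      ring_nf
    rw [h2] at h1
    exact le_of_mul_le_mul_right h1 (by positivity)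
  have hKC : K ≤ C.card := by
    have : (K : ℝ) ≤ C.card := by
      refine hKM.trans (le_trans ?_ hC2)
      rw [hM]
      refine Real.rpow_le_rpow_of_exponent_le one_le_two ?_
      rw [mul_comm]
      gcongr
      rw [hκ]
      linarith
    exact_mod_cast this
  have hB : 0 < C.card / K := Nat.div_pos hKC hK1
  obtain ⟨c, hc⟩ := exists_consensusCode hp hq hB hα0 hα1 (a := p' ^ (δ * n)) (by positivity)
    (by
      calc p ^ (⌊δ * (n : ℝ)⌋₊ + 1) ≤ p' ^ (⌊δ * (n : ℝ)⌋₊ + 1) :=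
            pow_le_pow_left₀ hp.1 (le_max_left _ _) _
        _ = p' ^ ((⌊δ * (n : ℝ)⌋₊ + 1 : ℕ) : ℝ) := (Real.rpow_natCast _ _).symm
        _ ≤ _ := Real.rpow_le_rpow_of_exponent_ge hp'0 hp'1.le (by
            push_cast
            exact (Nat.lt_floor_add_one _).le))
    hCsep (Nat.mul_div_le C.card K) hγ0 (hγ n)
  refine ⟨c, hc.trans (le_trans ?_ (hn₀ n hn))⟩
  have e1 : γ ^ n ≤ r ^ n := pow_le_pow_left₀ hγ0 hrγ n
  have e2 : p' ^ (δ * n) ≤ r ^ n := by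
    rw [Real.rpow_mul_natCast hp'0.le]
    exact pow_le_pow_left₀ (by positivity) hrδ n
  have e3 : 2 * ((2 : ℝ) ^ (n * (1 - τ)) * G) / (C.card / K : ℕ) ≤ 4 * r ^ n := by
    -- The integer quotient `C.card / K` is positive, so rounding loses at most a factor `2`.
    have hBlow : (C.card : ℝ) ≤ 2 * M * (C.card / K : ℕ) := by
      have h1 : C.card < K * (C.card / K + 1) := by
        have := Nat.div_add_mod C.card K
        have := Nat.mod_lt C.card hK1
        rw [Nat.mul_add]
        omega
      have h2 : C.card ≤ K * (2 * (C.card / K)) :=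
        h1.le.trans (Nat.mul_le_mul_left _ (by omega))
      calc (C.card : ℝ) ≤ K * (2 * (C.card / K : ℕ)) := by exact_mod_cast h2
        _ ≤ M * (2 * (C.card / K : ℕ)) := by gcongr
        _ = _ := by ring
    have hB0 : (0 : ℝ) < (C.card / K : ℕ) := by exact_mod_cast hB
    rw [div_le_iff₀ hB0]
    have h3 : (2 : ℝ) ^ (n * (1 - τ)) * (2 : ℝ) ^ (κ * n) * M =
        ((2 : ℝ) ^ (-(2 * κ))) ^ n * (2 : ℝ) ^ ((1 - κ) * n) := by
      rw [hM, ← Real.rpow_mul_natCast zero_le_two, ← Real.rpow_add two_pos,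
        ← Real.rpow_add two_pos, ← Real.rpow_add two_pos]
      congr 1
      rw [hκ]
      ring
    have h4 : ((2 : ℝ) ^ (-(2 * κ))) ^ n ≤ r ^ n := pow_le_pow_left₀ (by positivity) hrκ n
    have hM0 : 0 < M := by linarith
    refine le_of_mul_le_mul_right ?_ hM0
    calc 2 * ((2 : ℝ) ^ (n * (1 - τ)) * G) * M
        ≤ 2 * ((2 : ℝ) ^ (n * (1 - τ)) * (2 : ℝ) ^ (κ * n)) * M := by gcongr
      _ = 2 * (((2 : ℝ) ^ (-(2 * κ))) ^ n * (2 : ℝ) ^ ((1 - κ) * n)) := by rw [← h3]; ring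
      _ ≤ 2 * (r ^ n * (2 * M * (C.card / K : ℕ))) := by
          gcongr
          exact hC2.trans hBlow
      _ = _ := by ring
  have e4 : p' ^ (δ * n) * (n + 1) ≤ r ^ n * (n + 1) := by gcongr
  calc _ ≤ 2 * (r ^ n + (4 * r ^ n + r ^ n * (n + 1))) := by linarith
    _ = _ := by ring
end

/-! ### The consensus capacity and the final bounds -/

section
variable {p q : ℝ} (hp : p ∈ Set.Icc (0 : ℝ) 1) (hq : q ∈ Set.Ioc (0 : ℝ) 1)

theorem achievable_zero : (twoStepErasure p q hp hq).Achievable 0 := by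
  -- With a single message and constant decoders the error is zero, so any `ε` serves.
  refine ⟨1, one_pos, 0, fun n _ => ?_⟩
  have hK : ⌊(2 : ℝ) ^ ((n : ℝ) * 0)⌋₊ = 1 := by simp
  rw [hK]
  refine ⟨⟨fun _ _ => true, fun _ => some 0, fun _ => some 0⟩, ?_⟩
  refine ConsensusCode.errorProb_le _ _ (by positivity) (fun m => ?_) fun x => ?_
  · have h : ((twoStepErasure p q hp hq).condProb (fun _ : Fin n => true) fun _ _ => True) = 1 :=
      ((twoStepErasure p q hp hq).condProb_fst _ fun _ => True).trans
        (FiniteChannel.wordProb_true _ _)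
    simp only [ConsensusCode.honestError, Fin.fin_one_eq_zero m, and_self, h, sub_self]
    positivity
  · simp only [ConsensusCode.disagreement, BroadcastChannel.condProb, ne_eq, not_true_eq_false,
      if_false, Finset.sum_const_zero]
    positivity

theorem isLUB_achievableRates_of_lt_one (hp1 : p < 1) :
    IsLUB (twoStepErasure p q hp hq).achievableRates (1 - p * q) := by
  refine ⟨fun R hR => le_of_achievable hp hq hR.1 hR.2, fun b hb => ?_⟩
  refine le_of_forall_lt_imp_le_of_dense fun R hR => ?_
  have h0 : 0 ≤ b := hb ⟨le_rfl, achievable_zero hp hq⟩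
  rcases le_or_gt 0 R with hR0 | hR0
  · exact hb ⟨hR0, achievable_of_lt hp hq hp1 hR0 hR⟩
  · linarith

theorem not_achievable_one (h1 : (1 : ℝ) ∈ Set.Icc (0 : ℝ) 1) {R : ℝ} (hR : 0 < R) :
    ¬ (twoStepErasure 1 q h1 hq).Achievable R := by
  rintro ⟨ε, hε, n₀, hc⟩
  have hr1 : (2 : ℝ) ^ (-ε) < 1 := Real.rpow_lt_one_of_one_lt_of_neg one_lt_two (by linarith)
  have hr0 : (0 : ℝ) ≤ 2 ^ (-ε) := by positivity
  have t1 : Filter.Tendsto (fun n : ℕ => 2 * ((2 : ℝ) ^ (-ε)) ^ n +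
      2 / q * (n * ((2 : ℝ) ^ (-ε)) ^ n)) Filter.atTop (nhds (2 * 0 + 2 / q * 0)) :=
    ((tendsto_pow_atTop_nhds_zero_of_lt_one hr0 hr1).const_mul 2).add
      ((tendsto_self_mul_const_pow_of_lt_one hr0 hr1).const_mul (2 / q))
  have t1' := t1.eventually_lt_const (show 2 * 0 + 2 / q * 0 < (1 : ℝ) by norm_num)
  have t2 : ∀ᶠ n : ℕ in Filter.atTop, 1 / R ≤ n :=
    tendsto_natCast_atTop_atTop.eventually_ge_atTop (1 / R)
  obtain ⟨n, ⟨ha, hb⟩, hn⟩ := ((t1'.and t2).and (Filter.eventually_ge_atTop n₀)).exists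
  obtain ⟨c, hPe⟩ := hc n hn
  -- The condition `n ≥ 1 / R` guarantees the two messages needed for the lower bound.
  have hK : 2 ≤ ⌊(2 : ℝ) ^ ((n : ℝ) * R)⌋₊ := by
    refine Nat.le_floor ?_
    have : 1 ≤ (n : ℝ) * R := (div_le_iff₀ hR).1 hb
    simpa using Real.rpow_le_rpow_of_exponent_le one_le_two this
  have hlow := (one_div_le_errorProb h1 hq hK c).trans hPe
  have hq0 := hq.1
  rw [show -((n : ℝ) * ε) = -ε * n by ring, Real.rpow_mul_natCast zero_le_two,
    div_le_iff₀ (by positivity)] at hlow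
  linarith

theorem isLUB_achievableRates_one (h1 : (1 : ℝ) ∈ Set.Icc (0 : ℝ) 1) :
    IsLUB (twoStepErasure 1 q h1 hq).achievableRates 0 :=
  ⟨fun _ hR => not_lt.1 fun h => not_achievable_one hq h1 h hR.2,
    fun _ hb => hb ⟨le_rfl, achievable_zero h1 hq⟩⟩

end

theorem two_div_le_five_div_min {q : ℝ} (hq0 : 0 < q) (hq1 : q < 1) :
    2 / q ≤ 5 / min (q ^ 2) ((1 - q) ^ 2) := by
  have h1 : 0 < 1 - q := sub_pos.2 hq1
  have hmin : min (q ^ 2) ((1 - q) ^ 2) ≤ q :=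
    (min_le_left _ _).trans (by nlinarith)
  exact div_le_div₀ (by norm_num) (by norm_num) (lt_min (by positivity) (by positivity)) hmin

theorem mainTheorem2 (p q : ℝ) (hp : p ∈ Set.Icc (0 : ℝ) 1) (hq : q ∈ Set.Ioc (0 : ℝ) 1) :
    -- all capacities are well defined: the maxima are attained, the supremum is finite
    IsGreatest (twoStepErasure p q hp hq).commonMessageValues
        (twoStepErasure p q hp hq).commonMessageCapacity ∧
    IsGreatest (twoStepErasure p q hp hq).commonChannel.infoValues
        (twoStepErasure p q hp hq).commonChannel.capacity ∧
    IsLUB (twoStepErasure p q hp hq).achievableRates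
        (twoStepErasure p q hp hq).consensusCapacity ∧
    -- values of the common-message capacity and of the common-channel capacity
    (twoStepErasure p q hp hq).commonMessageCapacity = 1 - p * q ∧
    (twoStepErasure p q hp hq).commonChannel.capacity = 1 - p ∧
    -- the consensus capacity for `p < 1`
    (p < 1 →
      (twoStepErasure p q hp hq).consensusCapacity = 1 - p * q ∧
      (twoStepErasure p q hp hq).consensusCapacity =
        (twoStepErasure p q hp hq).commonMessageCapacity ∧
      (twoStepErasure p q hp hq).commonChannel.capacity ≤
        (twoStepErasure p q hp hq).consensusCapacity ∧
      (0 < p → q < 1 →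
        (twoStepErasure p q hp hq).commonChannel.capacity <
          (twoStepErasure p q hp hq).consensusCapacity)) ∧
    -- the consensus capacity for `p = 1`
    (p = 1 → (twoStepErasure p q hp hq).consensusCapacity = 0) ∧
    -- lower bound on the error probability for `p = 1`
    (p = 1 → q < 1 →
      ∀ (n K : ℕ) (c : ConsensusCode Bool ErasureOutput ErasureOutput n K), 2 ≤ K →
        1 / (2 + (n : ℝ) * (5 / min (q ^ 2) ((1 - q) ^ 2))) ≤
          c.errorProb (twoStepErasure p q hp hq)) := by
  have hM := isGreatest_commonMessageValues hp hq
  have hV := isGreatest_commonChannel_infoValues hp hq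
  have hMc : (twoStepErasure p q hp hq).commonMessageCapacity = 1 - p * q := hM.csSup_eq
  have hVc : (twoStepErasure p q hp hq).commonChannel.capacity = 1 - p := hV.csSup_eq
  have hlt : p < 1 → (twoStepErasure p q hp hq).consensusCapacity = 1 - p * q := fun h =>
    (isLUB_achievableRates_of_lt_one hp hq h).csSup_eq ⟨0, le_rfl, achievable_zero hp hq⟩
  have hone : p = 1 → IsLUB (twoStepErasure p q hp hq).achievableRates 0 := by
    rintro rfl
    exact isLUB_achievableRates_one hq hp
  have hone' : p = 1 → (twoStepErasure p q hp hq).consensusCapacity = 0 := fun h =>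
    (hone h).csSup_eq ⟨0, le_rfl, achievable_zero hp hq⟩
  refine ⟨hMc ▸ hM, hVc ▸ hV, ?_, hMc, hVc, fun h => ⟨hlt h, (hlt h).trans hMc.symm, ?_, ?_⟩,
    hone', ?_⟩
  · rcases hp.2.lt_or_eq with h | h
    · rw [hlt h]
      exact isLUB_achievableRates_of_lt_one hp hq h
    · rw [hone' h]
      exact hone h
  · rw [hVc, hlt h]
    linarith [mul_le_of_le_one_right hp.1 hq.2]
  · intro hp0 hq1
    rw [hVc, hlt h]
    linarith [mul_lt_of_lt_one_right hp0 hq1]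
  · rintro rfl hq1 n K c hK
    refine le_trans ?_ (one_div_le_errorProb hp hq hK c)
    have hq0 := hq.1
    have := two_div_le_five_div_min hq0 hq1
    gcongr
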